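/- Let $n>2$, $0<s<1$, let $\Omega\subset\mathbb R^n$ be open, and let $\Pi_1,\Pi_2$ be disjoint relatively open subsets of $\mathbb R^n\setminus\Omega$ with $\overline{\Pi_1}\cup\overline{\Pi_2}=\mathbb R^n\setminus\Omega$. Put $D=\Omega\cup\Pi_2$, $D_\Omega=\mathbb R^{2n}\setminus(\Omega^c\times\Omega^c)$, $2^*=\frac{2n}{n-2}$, $C_{n,s}=\Big(\int_{\mathbb R^n}\frac{1-\cos\zeta_1}{|\zeta|^{n+2s}}\,d\zeta\Big)^{-1}$, and let $\mathcal X^s(D)$ be the completion of $C_0^\infty(D)$ in the norm $$\eta(u)^2=\|\nabla u\|_{L^2(\mathbb R^n)}^2+C_{n,s}\int_{D_\Omega}\frac{|u(x)-u(y)|^2}{|x-y|^{n+2s}}\,dx\,dy,$$ regarded, by the Sobolev inequality, as a space of functions in $L^{2^*}(\mathbb R^n)$. For $u,\varphi\in\mathcal X^s(D)$ put $$\mathcal E(u,\varphi)=\frac{C_{n,s}}2\int_{D_\Omega}\frac{(u(x)-u(y))(\varphi(x)-\varphi(y))}{|x-y|^{n+2s}}\,dx\,dy+\int_{\mathbb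 R^n}\nabla u\cdot\nabla\varphi\,dx .$$ Let $g:\Omega\times(0,\infty)\to\mathbb R$ be a Carathéodory function (measurable in $x$ for every $\varrho$, continuous in $\varrho$ for a.e. $x$) such that for a.e. $x\in\Omega$ the function $\varrho\mapsto g(x,\varrho)/\varrho$ is strictly decreasing on $(0,\infty)$. Let $u,v\in\mathcal X^s(D)$ satisfy $u>0$ and $v>0$ a.e. in $\Omega$, and let $\mathcal L v\ge g(x,v)$ and $\mathcal L u\le g(x,u)$, where $\mathcal L=-\Delta+(-\Delta)^s$, in the weak sense: for every $\varphi\in\mathcal X^s(D)$ with $\varphi\ge0$ a.e., the functions $g(\cdot,v)\varphi$ and $g(\cdot,u)\varphi$ are integrable on $\Omega$ and $$\mathcal E(v,\varphi)\ge\int_\Omega g(x,v)\varphi\,dx,\qquad \mathcal E(u,\varphi)\le\int_\Omega g(x,u)\varphi\,dx .$$ Then $v\ge u$ a.e. in $\Omega$. -/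

import Mathlib

open MeasureTheory Set Filter Topology
open scoped ENNReal

noncomputable section

namespace MixedLocalNonlocal

variable {n : ℕ}

/-- `φ ∈ C₀^∞(D)`: smooth, with compact support contained in `D`. -/
def IsTestFunction (D : Set (EuclideanSpace ℝ (Fin n))) (φ : EuclideanSpace ℝ (Fin n) → ℝ) :
    Prop :=
  ContDiff ℝ (⊤ : ℕ∞) φ ∧ HasCompactSupport φ ∧ tsupport φ ⊆ D

/-- `G` is a weak (distributional) gradient of `u` on the whole space: `∫ u ∂ₑψ = - ∫ (G · e) ψ`
for every `ψ ∈ C₀^∞(ℝⁿ)` and every direction `e`. -/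
def HasWeakGradient (u : EuclideanSpace ℝ (Fin n) → ℝ)
    (G : EuclideanSpace ℝ (Fin n) → EuclideanSpace ℝ (Fin n)) : Prop :=
  LocallyIntegrable u volume ∧ LocallyIntegrable G volume ∧
    ∀ ψ : EuclideanSpace ℝ (Fin n) → ℝ, IsTestFunction univ ψ →
      ∀ e : EuclideanSpace ℝ (Fin n),
        ∫ x, u x * fderiv ℝ ψ x e = - ∫ x, inner ℝ (G x) e * ψ x

open Classical in
/-- The weak gradient `∇u` (unique up to null sets; `0` if `u` has none). -/
def weakGradient (u : EuclideanSpace ℝ (Fin n) → ℝ) :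
    EuclideanSpace ℝ (Fin n) → EuclideanSpace ℝ (Fin n) :=
  if h : ∃ G, HasWeakGradient u G then h.choose else 0

/-- The normalizing constant `C_{n,s} = (∫ (1 - cos ζ₁) / |ζ|^{n+2s} dζ)⁻¹`. -/
def fracConst (n : ℕ) [NeZero n] (s : ℝ) : ℝ :=
  (∫ ζ : EuclideanSpace ℝ (Fin n), (1 - Real.cos (ζ 0)) / ‖ζ‖ ^ ((n : ℝ) + 2 * s))⁻¹

/-- `D_Ω = ℝ²ⁿ \ (Ωᶜ × Ωᶜ)`. -/
def crossDomain (Ω : Set (EuclideanSpace ℝ (Fin n))) :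
    Set (EuclideanSpace ℝ (Fin n) × EuclideanSpace ℝ (Fin n)) :=
  (Ωᶜ ×ˢ Ωᶜ)ᶜ

/-- `[u]_s² = C_{n,s} ∫_{D_Ω} |u(x) - u(y)|² / |x - y|^{n+2s} dx dy`, with values in `[0, ∞]`. -/
def gagliardoSq [NeZero n] (s : ℝ) (Ω : Set (EuclideanSpace ℝ (Fin n)))
    (u : EuclideanSpace ℝ (Fin n) → ℝ) : ℝ≥0∞ :=
  ENNReal.ofReal (fracConst n s) *
    ∫⁻ p in crossDomain Ω,
      ENNReal.ofReal (|u p.1 - u p.2| ^ 2 / ‖p.1 - p.2‖ ^ ((n : ℝ) + 2 * s))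

/-- `η(u)² = ‖∇u‖²_{L²(ℝⁿ)} + [u]_s²` for weakly differentiable `u`. -/
def etaSq [NeZero n] (s : ℝ) (Ω : Set (EuclideanSpace ℝ (Fin n)))
    (u : EuclideanSpace ℝ (Fin n) → ℝ) : ℝ≥0∞ :=
  eLpNorm (weakGradient u) 2 volume ^ 2 + gagliardoSq s Ω u

/-- The critical Sobolev exponent `2^* = 2n/(n-2)` (for `n > 2`). -/
def sobolevExp (n : ℕ) : ℝ≥0∞ := ENNReal.ofReal (2 * (n : ℝ) / ((n : ℝ) - 2))

/-- The functions `u ∈ L^{2^*}(ℝⁿ)` with `∇u ∈ L²(ℝⁿ)` and `[u]_s < ∞`. -/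
def HasFiniteEnergy [NeZero n] (s : ℝ) (Ω : Set (EuclideanSpace ℝ (Fin n)))
    (u : EuclideanSpace ℝ (Fin n) → ℝ) : Prop :=
  MemLp u (sobolevExp n) volume ∧ (∃ G, HasWeakGradient u G) ∧
    MemLp (weakGradient u) 2 volume ∧ gagliardoSq s Ω u < ⊤

/-- `u ∈ 𝒳^s(D)`, `D = Ω ∪ P₂`: the completion of `C₀^∞(D)` for the norm `η`.
By the Sobolev inequality (`n > 2`) an `η`-Cauchy sequence in `C₀^∞(D)` converges in `L^{2^*}(ℝⁿ)`,
so the completion is the space of functions of finite energy that are limits, for `η` and in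
`L^{2^*}(ℝⁿ)`, of functions in `C₀^∞(D)`. Elements are functions on `ℝⁿ` up to null sets. -/
def MemX [NeZero n] (s : ℝ) (Ω P₂ : Set (EuclideanSpace ℝ (Fin n)))
    (u : EuclideanSpace ℝ (Fin n) → ℝ) : Prop :=
  HasFiniteEnergy s Ω u ∧
    ∃ φ : ℕ → EuclideanSpace ℝ (Fin n) → ℝ,
      (∀ k, IsTestFunction (Ω ∪ P₂) (φ k)) ∧
      Tendsto (fun k => eLpNorm (u - φ k) (sobolevExp n) volume) atTop (𝓝 0) ∧
      Tendsto (fun k => etaSq s Ω (u - φ k)) atTop (𝓝 0)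

/-- The bilinear form of `ℒ = -Δ + (-Δ)^s`:
`(C_{n,s}/2) ∫_{D_Ω} (u(x)-u(y))(φ(x)-φ(y)) / |x-y|^{n+2s} dx dy + ∫_{ℝⁿ} ∇u · ∇φ dx`. -/
def energyForm [NeZero n] (s : ℝ) (Ω : Set (EuclideanSpace ℝ (Fin n)))
    (u φ : EuclideanSpace ℝ (Fin n) → ℝ) : ℝ :=
  fracConst n s / 2 *
      (∫ p in crossDomain Ω,
        (u p.1 - u p.2) * (φ p.1 - φ p.2) / ‖p.1 - p.2‖ ^ ((n : ℝ) + 2 * s)) +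
    ∫ x, inner ℝ (weakGradient u x) (weakGradient φ x)

/-- `v` is a weak supersolution of `ℒv = g(x,v)` in `Ω` with the mixed boundary conditions:
`v ∈ 𝒳^s(D)`, and for every non-negative `φ ∈ 𝒳^s(D)` the pairing `∫_Ω g(x,v) φ` is well defined
and is at most the energy form of `v` and `φ`. -/
def IsWeakSupersolution [NeZero n] (s : ℝ) (Ω P₂ : Set (EuclideanSpace ℝ (Fin n)))
    (g : EuclideanSpace ℝ (Fin n) → ℝ → ℝ) (v : EuclideanSpace ℝ (Fin n) → ℝ) : Prop :=
  MemX s Ω P₂ v ∧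
    ∀ φ : EuclideanSpace ℝ (Fin n) → ℝ, MemX s Ω P₂ φ → (∀ᵐ x, 0 ≤ φ x) →
      IntegrableOn (fun x => g x (v x) * φ x) Ω ∧
        ∫ x in Ω, g x (v x) * φ x ≤ energyForm s Ω v φ

/-- `u` is a weak subsolution of `ℒu = g(x,u)` in `Ω` with the mixed boundary conditions. -/
def IsWeakSubsolution [NeZero n] (s : ℝ) (Ω P₂ : Set (EuclideanSpace ℝ (Fin n)))
    (g : EuclideanSpace ℝ (Fin n) → ℝ → ℝ) (u : EuclideanSpace ℝ (Fin n) → ℝ) : Prop :=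
  MemX s Ω P₂ u ∧
    ∀ φ : EuclideanSpace ℝ (Fin n) → ℝ, MemX s Ω P₂ φ → (∀ᵐ x, 0 ≤ φ x) →
      IntegrableOn (fun x => g x (u x) * φ x) Ω ∧
        energyForm s Ω u φ ≤ ∫ x in Ω, g x (u x) * φ x

/-- `g` is a Carathéodory function on `Ω × (0,∞)`: measurable in `x` for each `ρ`,
continuous in `ρ` for almost every `x`. -/
def IsCaratheodory (Ω : Set (EuclideanSpace ℝ (Fin n)))
    (g : EuclideanSpace ℝ (Fin n) → ℝ → ℝ) : Prop :=
  (∀ ρ ∈ Ioi (0 : ℝ), AEMeasurable (fun x => g x ρ) (volume.restrict Ω)) ∧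
    ∀ᵐ x ∂(volume.restrict Ω), ContinuousOn (g x) (Ioi 0)

/-- The geometric setting: `Ω` is open; the Dirichlet part `P₁` and the Neumann part `P₂` are
disjoint (relatively) open subsets of `ℝⁿ \ Ω` whose closures cover exactly `ℝⁿ \ Ω`. -/
structure IsMixedSetting (Ω P₁ P₂ : Set (EuclideanSpace ℝ (Fin n))) : Prop where
  isOpen : IsOpen Ω
  relOpen₁ : ∃ U, IsOpen U ∧ P₁ = U \ Ω
  relOpen₂ : ∃ U, IsOpen U ∧ P₂ = U \ Ω
  disjoint : P₁ ∩ P₂ = ∅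
  cover : closure P₁ ∪ closure P₂ = Ωᶜ

end MixedLocalNonlocal

end

/-! The proof is a Brezis–Oswald comparison through Picone's inequality. Test the inequality for `u`
with `v (u - v)⁺ / u` and the one for `v` with `(u - v)⁺`. Picone gives `ℰ(u, v (u - v)⁺ / u) ≥ ℰ(v,
(u - v)⁺)`, so the integral over `Ω` of `v (u - v)⁺ (g(x,v)/v - g(x,u)/u)` is at most `0`. As
`g(x,ρ)/ρ` strictly decreases, the integrand is nonnegative, and positive where `v < u`; that set is
therefore null.

No truncation or shift of the denominator is needed: where `0 ≤ v < u`, the first test function is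
the parallel sum of `v` and `u - v`, which is Lipschitz up to the origin. Admissibility is
`MemX.comp_lipschitz`: smooth the Lipschitz function, compose it with approximating test functions,
and use Mazur's lemma to pass from energy bounds to energy convergence.

Only the discrete Picone inequality `picone_increment_nonneg` is proved. It integrates directly to
the nonlocal term; applied to increments over a step `t e`, divided by `t²`, it gives the gradient
term as `t → 0`, so no chain rule for weak gradients enters (`energyForm_combination_nonneg`). It
requires `v ≥ 0` on all of `ℝⁿ`, which follows from testing the supersolution with its negative
part. -/

/-! ### Functional-analytic tools: Mazur's lemma, Lipschitz smoothing, dual pairings. -/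

/-- Mazur's lemma along a bounded sequence: in a product of a Hilbert space and a normed space,
a subspace containing `(x k, w k)`, with `x` bounded and `w` convergent to `w₀`, has a point
`(x₀, w₀)` in its closure. -/
theorem exists_mk_mem_closure_of_bounded_fst {H W : Type*} [NormedAddCommGroup H]
    [InnerProductSpace ℝ H] [CompleteSpace H] [NormedAddCommGroup W] [NormedSpace ℝ W]
    (V : Submodule ℝ (H × W)) (x : ℕ → H) (w : ℕ → W) (hV : ∀ k, (x k, w k) ∈ V) {R : ℝ}
    (hx : ∀ k, ‖x k‖ ≤ R) {w₀ : W} (hw : Tendsto w atTop (𝓝 w₀)) :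
    ∃ x₀, (x₀, w₀) ∈ closure (V : Set (H × W)) := by
  set S : ℕ → Set (H × W) := fun n => convexHull ℝ ((fun k => (x k, w k)) '' Ici n) with hS
  have hmem : ∀ n, (x n, w n) ∈ S n := fun n =>
    subset_convexHull ℝ _ (mem_image_of_mem _ (mem_Ici.2 le_rfl))
  have hanti : Antitone S := fun n m h => convexHull_mono (image_mono (Ici_subset_Ici.2 h))
  -- Distances from the origin to the first components of the tail hulls. They increase to a finite
  -- `D`, so nearly minimal points `y n` of the hulls are Cauchy in the first component, as in the
  -- projection theorem.
  set d : ℕ → ℝ := fun n => sInf ((fun z : H × W => ‖z.1‖) '' S n) with hd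
  have hbdd : ∀ n, BddBelow ((fun z : H × W => ‖z.1‖) '' S n) := fun n =>
    ⟨0, by rintro _ ⟨z, -, rfl⟩; exact norm_nonneg _⟩
  have hd_le : ∀ n, ∀ z ∈ S n, d n ≤ ‖z.1‖ := fun n z hz =>
    csInf_le (hbdd n) (mem_image_of_mem _ hz)
  have hd_nonneg : ∀ n, 0 ≤ d n := fun n =>
    Real.sInf_nonneg (by rintro _ ⟨z, -, rfl⟩; exact norm_nonneg _)
  have hd_mono : Monotone d := fun n m h =>
    csInf_le_csInf (hbdd n) ⟨_, mem_image_of_mem _ (hmem m)⟩ (image_mono (hanti h))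
  have hd_bdd : BddAbove (range d) :=
    ⟨R, by rintro _ ⟨n, rfl⟩; exact (hd_le n _ (hmem n)).trans (hx n)⟩
  have hd_lim := tendsto_atTop_ciSup hd_mono hd_bdd
  set D := ⨆ n, d n
  have hdD : ∀ n, d n ≤ D := fun n => le_ciSup hd_bdd n
  have hD : 0 ≤ D := (hd_nonneg 0).trans (hdD 0)
  have hex : ∀ n : ℕ, ∃ z ∈ S n, ‖z.1‖ < d n + 1 / ((n : ℝ) + 1) := by
    intro n
    obtain ⟨_, ⟨z, hz, rfl⟩, h⟩ := exists_lt_of_csInf_lt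
      (s := (fun z : H × W => ‖z.1‖) '' S n) ⟨_, mem_image_of_mem _ (hmem n)⟩
      (show d n < d n + 1 / ((n : ℝ) + 1) from lt_add_of_pos_right _ (by positivity))
    exact ⟨z, hz, h⟩
  choose y hyS hy using hex
  have heps : Tendsto (fun n : ℕ => 1 / ((n : ℝ) + 1)) atTop (𝓝 0) :=
    tendsto_one_div_add_atTop_nhds_zero_nat
  have hcauchy : CauchySeq fun n => (y n).1 := by
    refine cauchySeq_of_le_tendsto_0
      -- Parallelogram law: both norms are at most `D + 1/(N+1)`, and the midpoint lies in the hull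
      -- `S N`, so its norm is at least `d N`.
      (fun N : ℕ => Real.sqrt (4 * (D + 1 / ((N : ℝ) + 1)) ^ 2 - 4 * d N ^ 2)) ?_ ?_
    · intro n m N hn hm
      rw [dist_eq_norm]
      apply Real.le_sqrt_of_sq_le
      have hmid : (1 / 2 : ℝ) • y n + (1 / 2 : ℝ) • y m ∈ S N :=
        (convex_convexHull ℝ _) (hanti hn (hyS n)) (hanti hm (hyS m)) (by norm_num) (by norm_num)
          (by norm_num)
      have h1 := hd_le N _ hmid
      have h2 : ‖((1 / 2 : ℝ) • y n + (1 / 2 : ℝ) • y m).1‖ = 1 / 2 * ‖(y n).1 + (y m).1‖ := by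
        rw [Prod.fst_add, Prod.smul_fst, Prod.smul_fst, ← smul_add, norm_smul]
        norm_num
      rw [h2] at h1
      have hpar := parallelogram_law_with_norm ℝ (y n).1 (y m).1
      have hb : ∀ k, N ≤ k → ‖(y k).1‖ ≤ D + 1 / ((N : ℝ) + 1) := by
        intro k hk
        refine (hy k).le.trans (add_le_add (hdD k) ?_)
        have : (N : ℝ) ≤ k := by exact_mod_cast hk
        gcongr
      have hbn := hb n hn
      have hbm := hb m hm
      have h0 := hd_nonneg N
      have e1 : ‖(y n).1‖ ^ 2 ≤ (D + 1 / ((N : ℝ) + 1)) ^ 2 := by gcongr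
      have e2 : ‖(y m).1‖ ^ 2 ≤ (D + 1 / ((N : ℝ) + 1)) ^ 2 := by gcongr
      have e3 : d N ^ 2 ≤ (1 / 2 * ‖(y n).1 + (y m).1‖) ^ 2 := by gcongr
      nlinarith
    · have : Tendsto (fun N : ℕ => Real.sqrt (4 * (D + 1 / ((N : ℝ) + 1)) ^ 2 - 4 * d N ^ 2))
          atTop (𝓝 (Real.sqrt (4 * (D + 0) ^ 2 - 4 * D ^ 2))) :=
        ((((heps.const_add D).pow 2).const_mul 4).sub ((hd_lim.pow 2).const_mul 4)).sqrt
      simpa using this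
  obtain ⟨x₀, hx₀⟩ := cauchySeq_tendsto_of_complete hcauchy
  have hy2 : Tendsto (fun n => (y n).2) atTop (𝓝 w₀) := by
    rw [Metric.tendsto_atTop]
    intro ε hε
    obtain ⟨N, hN⟩ := Metric.tendsto_atTop.1 hw ε hε
    refine ⟨N, fun n hn => ?_⟩
    -- Balls are convex, so convex combinations of a tail of `w` remain as close to `w₀` as the tail
    -- itself.
    have hsub : S n ⊆ LinearMap.snd ℝ H W ⁻¹' Metric.ball w₀ ε := by
      refine convexHull_min ?_ ((convex_ball w₀ ε).linear_preimage _)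
      rintro _ ⟨k, hk, rfl⟩
      exact hN k (hn.le.trans hk)
    exact hsub (hyS n)
  refine ⟨x₀, mem_closure_of_tendsto (hx₀.prodMk_nhds hy2) (Eventually.of_forall fun n => ?_)⟩
  refine (convexHull_min ?_ V.convex : S n ⊆ V) (hyS n)
  rintro _ ⟨k, -, rfl⟩
  exact hV k

/-- A Lipschitz function vanishing at `0` is a uniform limit of smooth functions vanishing at `0`
with the same Lipschitz constant. -/
theorem LipschitzWith.exists_contDiff_dist_le {E : Type*} [NormedAddCommGroup E] [NormedSpace ℝ E]
    [FiniteDimensional ℝ E] [MeasurableSpace E] [BorelSpace E] {F : E → ℝ} {L : NNReal}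
    (hF : LipschitzWith L F) (hF0 : F 0 = 0) {δ : ℝ} (hδ : 0 < δ) :
    ∃ G : E → ℝ, ContDiff ℝ (⊤ : ℕ∞) G ∧ LipschitzWith L G ∧ G 0 = 0 ∧ ∀ x, |G x - F x| ≤ δ := by
  set μ : Measure E := Measure.addHaar
  -- Mollification at radius `r` costs at most `δ / 2`; subtracting `K 0` to restore the value at
  -- `0` costs another `δ / 2`. The `+ 1` covers `L = 0`.
  set r : ℝ := δ / (2 * (L + 1)) with hr
  have hr0 : 0 < r := by positivity
  let φ : ContDiffBump (0 : E) := ⟨r / 2, r, by positivity, by linarith⟩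
  set K : E → ℝ := convolution (φ.normed μ) F (ContinuousLinearMap.lsmul ℝ ℝ) μ with hK
  have hKF : ∀ x, |K x - F x| ≤ δ / 2 := by
    intro x
    rw [← Real.dist_eq]
    refine φ.dist_normed_convolution_le hF.continuous.aestronglyMeasurable fun y hy => ?_
    refine (hF.dist_le_mul y x).trans ?_
    have h1 : dist y x ≤ r := (Metric.mem_ball.1 hy).le
    calc (L : ℝ) * dist y x ≤ (L + 1) * r := by gcongr; linarith
      _ = δ / 2 := by rw [hr]; field_simp
  have hint : ∀ x, Integrable (fun t => φ.normed μ t • F (x - t)) μ := fun x =>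
    (φ.continuous_normed.smul (hF.continuous.comp (continuous_const.sub continuous_id))
      ).integrable_of_hasCompactSupport φ.hasCompactSupport_normed.smul_right
  have hKL : LipschitzWith L K := by
    refine LipschitzWith.of_dist_le_mul fun x y => ?_
    rw [dist_eq_norm]
    have : K x - K y = ∫ t, φ.normed μ t • (F (x - t) - F (y - t)) ∂μ := by
      simp only [hK, convolution_def, ContinuousLinearMap.lsmul_apply]
      rw [← integral_sub (hint x) (hint y)]
      simp only [smul_sub]
    rw [this]
    calc ‖∫ t, φ.normed μ t • (F (x - t) - F (y - t)) ∂μ‖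
        ≤ ∫ t, φ.normed μ t * (L * dist x y) ∂μ := by
          refine norm_integral_le_of_norm_le (φ.integrable_normed.mul_const _)
            (Eventually.of_forall fun t => ?_)
          rw [norm_smul, Real.norm_of_nonneg (φ.nonneg_normed t)]
          refine mul_le_mul_of_nonneg_left ?_ (φ.nonneg_normed t)
          have := hF.dist_le_mul (x - t) (y - t)
          rwa [dist_eq_norm, dist_sub_right] at this
      _ = L * dist x y := by rw [integral_mul_const, φ.integral_normed, one_mul]
  refine ⟨fun x => K x - K 0, ?_, ?_, sub_self _, fun x => ?_⟩
  · refine ContDiff.sub ?_ contDiff_const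
    exact φ.hasCompactSupport_normed.contDiff_convolution_left _ φ.contDiff_normed
      hF.continuous.locallyIntegrable
  · exact LipschitzWith.of_dist_le_mul fun x y => by
      simpa [dist_sub_right] using hKL.dist_le_mul x y
  · have h1 := abs_le.1 (hKF x)
    have h2 := abs_le.1 (hKF 0)
    rw [hF0, sub_zero] at h2
    rw [abs_le]
    constructor <;> linarith

theorem integral_mul_eq_lpPairing {α : Type*} [MeasurableSpace α] {μ : Measure α}
    {p q : ℝ≥0∞} [Fact (1 ≤ p)] [Fact (1 ≤ q)] [p.HolderConjugate q] {a b : α → ℝ}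
    (ha : MemLp a p μ) (hb : MemLp b q μ) : ∫ x, a x * b x ∂μ =
      (ContinuousLinearMap.mul ℝ ℝ).lpPairing μ p q (ha.toLp a) (hb.toLp b) := by
  rw [ContinuousLinearMap.lpPairing_eq_integral]
  refine integral_congr_ae ?_
  filter_upwards [ha.coeFn_toLp, hb.coeFn_toLp] with x h1 h2
  rw [h1, h2, ContinuousLinearMap.mul_apply']

/-- Continuity of the pairing `∫ f * h` under convergence in `L^p` and in `L^q`. -/
theorem tendsto_integral_mul_of_tendsto_eLpNorm {α ι : Type*} [MeasurableSpace α] {μ : Measure α}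
    {p q : ℝ≥0∞} [Fact (1 ≤ p)] [Fact (1 ≤ q)] [p.HolderConjugate q] {l : Filter ι}
    {f : ι → α → ℝ} {h : ι → α → ℝ} {f₀ h₀ : α → ℝ} (hf : ∀ i, MemLp (f i) p μ)
    (hf₀ : MemLp f₀ p μ) (hh : ∀ i, MemLp (h i) q μ) (hh₀ : MemLp h₀ q μ)
    (hfl : Tendsto (fun i => eLpNorm (f i - f₀) p μ) l (𝓝 0))
    (hhl : Tendsto (fun i => eLpNorm (h i - h₀) q μ) l (𝓝 0)) :
    Tendsto (fun i => ∫ x, f i x * h i x ∂μ) l (𝓝 (∫ x, f₀ x * h₀ x ∂μ)) := by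
  rw [integral_mul_eq_lpPairing hf₀ hh₀]
  simp_rw [fun i => integral_mul_eq_lpPairing (hf i) (hh i)]
  have h1 := (Lp.tendsto_Lp_iff_tendsto_eLpNorm'' f hf f₀ hf₀).2 hfl
  have h2 := (Lp.tendsto_Lp_iff_tendsto_eLpNorm'' h hh h₀ hh₀).2 hhl
  generalize (ContinuousLinearMap.mul ℝ ℝ).lpPairing μ p q = B
  exact (B.isBoundedBilinearMap.continuous.tendsto (hf₀.toLp f₀, hh₀.toLp h₀)).comp
    (h1.prodMk_nhds h2)

/-! ### The Picone test functions and the discrete Picone inequality. -/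

/-- The parallel sum `p q / (p + q)`, which vanishes at `p = q = 0`. -/
noncomputable def parallelSum (p q : ℝ) : ℝ := p * q / (p + q)

/-- A change from `r` to `p` in one argument is multiplied by `q² / ((p + q)(r + q)) ≤ 1`; symmetry
handles the other argument. -/
theorem abs_parallelSum_sub_le {p q r t : ℝ} (hp : 0 ≤ p) (hq : 0 ≤ q) (hr : 0 ≤ r) (ht : 0 ≤ t) :
    |parallelSum p q - parallelSum r t| ≤ |p - r| + |q - t| := by
  have key : ∀ {p q r : ℝ}, 0 ≤ p → 0 ≤ q → 0 ≤ r →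
      |parallelSum p q - parallelSum r q| ≤ |p - r| := by
    intro p q r hp hq hr
    unfold parallelSum
    rcases hq.eq_or_lt with rfl | hq
    · simp
    have h1 : 0 < p + q := by linarith
    have h2 : 0 < r + q := by linarith
    have : p * q / (p + q) - r * q / (r + q) = (p - r) * (q * q / ((p + q) * (r + q))) := by
      field_simp; ring
    rw [this, abs_mul, abs_of_nonneg (a := q * q / _) (by positivity)]
    refine mul_le_of_le_one_right (abs_nonneg _) ((div_le_one (by positivity)).2 ?_)
    nlinarith [mul_nonneg hp hr, mul_nonneg hp hq.le, mul_nonneg hr hq.le]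
  have comm : ∀ p q, parallelSum p q = parallelSum q p := fun p q => by
    unfold parallelSum; rw [mul_comm, add_comm]
  calc |parallelSum p q - parallelSum r t|
      ≤ |parallelSum p q - parallelSum r q| + |parallelSum r q - parallelSum r t| :=
        abs_sub_le _ _ _
    _ ≤ |p - r| + |q - t| := by
        refine add_le_add (key hp hq hr) ?_
        rw [comm r q, comm r t]
        exact key hq hr ht

/-- The Picone test function `c (a - c)⁺ / a` at `z = (a, c)`, Lipschitz in both variables. -/
noncomputable def piconeFst (z : ℝ × ℝ) : ℝ := parallelSum (max z.2 0) (max (z.1 - max z.2 0) 0)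

theorem piconeFst_nonneg (z : ℝ × ℝ) : 0 ≤ piconeFst z := by
  unfold piconeFst parallelSum; positivity

theorem piconeFst_of_lt {a c : ℝ} (hc : 0 ≤ c) (h : c < a) :
    piconeFst (a, c) = c * (a - c) / a := by
  simp [piconeFst, parallelSum, hc, h.le]

theorem piconeFst_of_le {a c : ℝ} (hc : 0 ≤ c) (h : a ≤ c) : piconeFst (a, c) = 0 := by
  simp [piconeFst, parallelSum, hc, h]

/-- The positive part of the difference. -/
noncomputable def posSub (z : ℝ × ℝ) : ℝ := max (z.1 - z.2) 0

/-- The positive parts in the definition make the bound hold on the whole plane, as needed for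
composition with approximants of arbitrary sign. The variable `c` enters both arguments of the
parallel sum and `a` one, hence `3`. -/
theorem lipschitzWith_piconeFst : LipschitzWith 3 piconeFst := by
  refine LipschitzWith.of_dist_le_mul fun z w => ?_
  rw [Real.dist_eq, Prod.dist_eq, Real.dist_eq, Real.dist_eq]
  refine (abs_parallelSum_sub_le (le_max_right _ _) (le_max_right _ _) (le_max_right _ _)
    (le_max_right _ _)).trans ?_
  have h1 := abs_max_sub_max_le_abs z.2 w.2 0
  have h2 := abs_max_sub_max_le_abs (z.1 - max z.2 0) (w.1 - max w.2 0) 0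
  have h3 : |z.1 - max z.2 0 - (w.1 - max w.2 0)| ≤ |z.1 - w.1| + |max z.2 0 - max w.2 0| := by
    rw [show z.1 - max z.2 0 - (w.1 - max w.2 0) = (z.1 - w.1) - (max z.2 0 - max w.2 0) by ring]
    exact abs_sub _ _
  have h4 := le_max_left |z.1 - w.1| |z.2 - w.2|
  have h5 := le_max_right |z.1 - w.1| |z.2 - w.2|
  push_cast
  linarith

theorem lipschitzWith_posSub : LipschitzWith 2 posSub := by
  refine LipschitzWith.of_dist_le_mul fun z w => ?_
  rw [Real.dist_eq, Prod.dist_eq, Real.dist_eq, Real.dist_eq]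
  have h2 := abs_max_sub_max_le_abs (z.1 - z.2) (w.1 - w.2) 0
  have h3 : |z.1 - z.2 - (w.1 - w.2)| ≤ |z.1 - w.1| + |z.2 - w.2| := by
    rw [show z.1 - z.2 - (w.1 - w.2) = (z.1 - w.1) - (z.2 - w.2) by ring]
    exact abs_sub _ _
  have h4 := le_max_left |z.1 - w.1| |z.2 - w.2|
  have h5 := le_max_right |z.1 - w.1| |z.2 - w.2|
  unfold posSub
  push_cast
  linarith

/-- A discrete Picone inequality. -/
theorem picone_increment_nonneg {a b c d : ℝ} (hc : 0 ≤ c) (hd : 0 ≤ d) :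
    0 ≤ (a - b) * (piconeFst (a, c) - piconeFst (b, d)) -
      (c - d) * (posSub (a, c) - posSub (b, d)) := by
  rcases lt_or_ge c a with hca | hca <;> rcases lt_or_ge d b with hdb | hdb
  · rw [piconeFst_of_lt hc hca, piconeFst_of_lt hd hdb, posSub, posSub,
      max_eq_left (by simpa using hca.le), max_eq_left (by simpa using hdb.le)]
    have ha : 0 < a := by linarith
    have hb : 0 < b := by linarith
    -- Where both positive parts are active, the difference is exactly a Picone square.
    have : (a - b) * (c * (a - c) / a - d * (b - d) / b) - (c - d) * ((a - c) - (b - d)) =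
        (a * d - c * b) ^ 2 / (a * b) := by
      field_simp; ring
    simp only [this]
    positivity
  · rw [piconeFst_of_lt hc hca, piconeFst_of_le hd hdb, posSub, posSub,
      max_eq_left (by simpa using hca.le), max_eq_right (by simpa using hdb)]
    have ha : 0 < a := by linarith
    have : (a - b) * (c * (a - c) / a - 0) - (c - d) * (a - c - 0) =
        (a - c) * (a * d - c * b) / a := by
      field_simp; ring
    simp only [this]
    -- `c b ≤ c d ≤ a d`, from `b ≤ d` and `c < a`; the sign of `b` is irrelevant.
    have : c * b ≤ a * d := by nlinarith
    exact div_nonneg (mul_nonneg (by linarith) (by linarith)) ha.le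
  · rw [piconeFst_of_le hc hca, piconeFst_of_lt hd hdb, posSub, posSub,
      max_eq_right (by simpa using hca), max_eq_left (by simpa using hdb.le)]
    have hb : 0 < b := by linarith
    have : (a - b) * (0 - d * (b - d) / b) - (c - d) * (0 - (b - d)) =
        (b - d) * (b * c - d * a) / b := by
      field_simp; ring
    simp only [this]
    have : d * a ≤ b * c := by nlinarith
    exact div_nonneg (mul_nonneg (by linarith) (by linarith)) hb.le
  · rw [piconeFst_of_le hc hca, piconeFst_of_le hd hdb, posSub, posSub,
      max_eq_right (by simpa using hca), max_eq_right (by simpa using hdb)]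
    simp

/-! ### Estimates in `L^p`. -/

theorem eLpNorm_le_mul_add_of_norm_le {α A B C : Type*} [MeasurableSpace α] {μ : Measure α}
    [NormedAddCommGroup A] [NormedAddCommGroup B] [NormedAddCommGroup C] {p : ℝ≥0∞}
    (hp : 1 ≤ p) {f : α → A} {g : α → B} {h : α → C} (hg : AEStronglyMeasurable g μ)
    (hh : AEStronglyMeasurable h μ) {L : ℝ} (hfgh : ∀ x, ‖f x‖ ≤ L * (‖g x‖ + ‖h x‖)) :
    eLpNorm f p μ ≤ ENNReal.ofReal L * (eLpNorm g p μ + eLpNorm h p μ) := by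
  have h1 : eLpNorm f p μ ≤ ENNReal.ofReal L * eLpNorm ((fun x => ‖g x‖) + fun x => ‖h x‖) p μ :=
    eLpNorm_le_mul_eLpNorm_of_ae_le_mul (Eventually.of_forall fun x => by
      rw [Pi.add_apply, Real.norm_of_nonneg (by positivity : 0 ≤ ‖g x‖ + ‖h x‖)]
      exact hfgh x) p
  refine h1.trans (mul_le_mul_right ((eLpNorm_add_le hg.norm hh.norm hp).trans_eq ?_) _)
  rw [eLpNorm_norm, eLpNorm_norm]

theorem exists_eLpNorm_le_of_tendsto {α A : Type*} [MeasurableSpace α] {μ : Measure α}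
    [NormedAddCommGroup A] {p : ℝ≥0∞} [Fact (1 ≤ p)] {f : ℕ → α → A} {g : α → A}
    (hf : ∀ k, MemLp (f k) p μ) (hg : MemLp g p μ)
    (h : Tendsto (fun k => eLpNorm (f k - g) p μ) atTop (𝓝 0)) :
    ∃ M : ℝ, ∀ k, eLpNorm (f k) p μ ≤ ENNReal.ofReal M := by
  have h1 := ((Lp.tendsto_Lp_iff_tendsto_eLpNorm'' f hf g hg).2 h).norm.bddAbove_range
  obtain ⟨M, hM⟩ := h1
  refine ⟨M, fun k => ?_⟩
  have := hM (mem_range_self k)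
  rw [Lp.norm_toLp] at this
  rw [← ENNReal.ofReal_toReal (hf k).2.ne]
  exact ENNReal.ofReal_le_ofReal this

theorem integral_mul_combination_nonneg {α : Type*} [MeasurableSpace α] {μ : Measure α}
    {a b c d : α → ℝ} (ha : MemLp a 2 μ) (hb : MemLp b 2 μ) (hc : MemLp c 2 μ) (hd : MemLp d 2 μ)
    {r q : ℝ} (h : ∀ᵐ x ∂μ, 0 ≤ r * (a x * b x) + q * (c x * d x)) :
    0 ≤ r * (∫ x, a x * b x ∂μ) + q * ∫ x, c x * d x ∂μ := by
  have h1 : Integrable (fun x => a x * b x) μ := ha.integrable_mul hb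
  have h2 : Integrable (fun x => c x * d x) μ := hc.integrable_mul hd
  rw [← integral_const_mul, ← integral_const_mul, ← integral_add (h1.const_mul r) (h2.const_mul q)]
  exact integral_nonneg_of_ae h

/-! ### Test functions and weak gradients. -/

namespace MixedLocalNonlocal

variable {n : ℕ}

local notation "𝔼" => EuclideanSpace ℝ (Fin n)

theorem IsTestFunction.differentiable {D : Set 𝔼} {φ : 𝔼 → ℝ} (h : IsTestFunction D φ) :
    Differentiable ℝ φ :=
  h.1.differentiable (by simp)

theorem IsTestFunction.memLp {D : Set 𝔼} {φ : 𝔼 → ℝ} (h : IsTestFunction D φ) (p : ℝ≥0∞) :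
    MemLp φ p :=
  h.1.continuous.memLp_of_hasCompactSupport h.2.1

theorem IsTestFunction.continuous_fderiv_apply {D : Set 𝔼} {φ : 𝔼 → ℝ} (h : IsTestFunction D φ)
    (e : 𝔼) : Continuous fun x => fderiv ℝ φ x e :=
  (h.1.continuous_fderiv (by simp)).clm_apply continuous_const

theorem IsTestFunction.hasCompactSupport_fderiv_apply {D : Set 𝔼} {φ : 𝔼 → ℝ}
    (h : IsTestFunction D φ) (e : 𝔼) : HasCompactSupport fun x => fderiv ℝ φ x e :=
  h.2.1.fderiv_apply ℝ e

theorem IsTestFunction.memLp_fderiv_apply {D : Set 𝔼} {φ : 𝔼 → ℝ} (h : IsTestFunction D φ) (e : 𝔼)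
    (p : ℝ≥0∞) : MemLp (fun x => fderiv ℝ φ x e) p :=
  (h.continuous_fderiv_apply e).memLp_of_hasCompactSupport (h.hasCompactSupport_fderiv_apply e)

theorem IsTestFunction.continuous_gradient {D : Set 𝔼} {φ : 𝔼 → ℝ} (h : IsTestFunction D φ) :
    Continuous (gradient φ) :=
  (InnerProductSpace.toDual ℝ 𝔼).symm.continuous.comp (h.1.continuous_fderiv (by simp))

theorem IsTestFunction.memLp_gradient {D : Set 𝔼} {φ : 𝔼 → ℝ} (h : IsTestFunction D φ)
    (p : ℝ≥0∞) : MemLp (gradient φ) p :=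
  h.continuous_gradient.memLp_of_hasCompactSupport
    ((h.2.1.fderiv ℝ).comp_left (map_zero (InnerProductSpace.toDual ℝ 𝔼).symm))

theorem IsTestFunction.gradient_sub {D : Set 𝔼} {φ ψ : 𝔼 → ℝ} (h : IsTestFunction D φ)
    (h' : IsTestFunction D ψ) : gradient (φ - ψ) = gradient φ - gradient ψ := by
  ext1 x
  simp only [gradient, Pi.sub_apply]
  rw [fderiv_sub (h.differentiable x) (h'.differentiable x), map_sub]

theorem IsTestFunction.gradient_add {D : Set 𝔼} {φ ψ : 𝔼 → ℝ} (h : IsTestFunction D φ)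
    (h' : IsTestFunction D ψ) : gradient (φ + ψ) = gradient φ + gradient ψ := by
  ext1 x
  simp only [gradient, Pi.add_apply]
  rw [fderiv_add (h.differentiable x) (h'.differentiable x), map_add]

theorem IsTestFunction.gradient_smul {D : Set 𝔼} {φ : 𝔼 → ℝ} (h : IsTestFunction D φ) (c : ℝ) :
    gradient (c • φ) = c • gradient φ := by
  ext1 x
  simp only [gradient, Pi.smul_apply]
  rw [fderiv_const_smul (h.differentiable x), map_smul]

theorem isTestFunction_zero (D : Set 𝔼) : IsTestFunction D 0 :=
  ⟨contDiff_const, HasCompactSupport.zero, by simp [tsupport]⟩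

theorem IsTestFunction.add {D : Set 𝔼} {φ ψ : 𝔼 → ℝ} (h : IsTestFunction D φ)
    (h' : IsTestFunction D ψ) : IsTestFunction D (φ + ψ) :=
  ⟨h.1.add h'.1, h.2.1.add h'.2.1, (tsupport_add φ ψ).trans (union_subset h.2.2 h'.2.2)⟩

theorem IsTestFunction.smul {D : Set 𝔼} {φ : 𝔼 → ℝ} (h : IsTestFunction D φ) (c : ℝ) :
    IsTestFunction D (c • φ) :=
  ⟨h.1.const_smul c, h.2.1.smul_left (f := fun _ => c),
    (tsupport_smul_subset_right (fun _ => c) φ).trans h.2.2⟩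

theorem IsTestFunction.sub {D : Set 𝔼} {φ ψ : 𝔼 → ℝ} (h : IsTestFunction D φ)
    (h' : IsTestFunction D ψ) : IsTestFunction D (φ - ψ) := by
  have := h.add (h'.smul (-1))
  rwa [neg_one_smul, ← sub_eq_add_neg] at this

theorem integrable_mul_fderiv_apply {u ψ : 𝔼 → ℝ} (hu : LocallyIntegrable u)
    (hψ : IsTestFunction univ ψ) (e : 𝔼) : Integrable fun x => u x * fderiv ℝ ψ x e :=
  hu.integrable_smul_right_of_hasCompactSupport (hψ.continuous_fderiv_apply e)
    (hψ.hasCompactSupport_fderiv_apply e)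

theorem integrable_smul_testFunction {G : 𝔼 → 𝔼} {ψ : 𝔼 → ℝ} (hG : LocallyIntegrable G)
    (hψ : IsTestFunction univ ψ) : Integrable fun x => ψ x • G x :=
  hG.integrable_smul_left_of_hasCompactSupport hψ.1.continuous hψ.2.1

theorem integrable_inner_mul_testFunction {G : 𝔼 → 𝔼} {ψ : 𝔼 → ℝ} (hG : LocallyIntegrable G)
    (hψ : IsTestFunction univ ψ) (e : 𝔼) : Integrable fun x => inner ℝ (G x) e * ψ x := by
  have := (integrable_smul_testFunction hG hψ).inner_const (𝕜 := ℝ) e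
  simpa [real_inner_smul_left, mul_comm] using this

/-- This is the fundamental lemma of the calculus of variations, with the vector integrals compared
by pairing with each `e`. It makes the choice in `weakGradient` immaterial. -/
theorem HasWeakGradient.ae_unique {u : 𝔼 → ℝ} {G G' : 𝔼 → 𝔼} (h : HasWeakGradient u G)
    (h' : HasWeakGradient u G') : G =ᵐ[volume] G' := by
  refine ae_eq_of_integral_contDiff_smul_eq h.2.1 h'.2.1 fun ψ hψ hψc => ?_
  have hψt : IsTestFunction univ ψ := ⟨hψ, hψc, subset_univ _⟩
  refine ext_inner_right ℝ fun e => ?_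
  have key : ∀ {K : 𝔼 → 𝔼}, HasWeakGradient u K →
      inner ℝ (∫ x, ψ x • K x) e = - ∫ x, u x * fderiv ℝ ψ x e := by
    intro K hK
    rw [hK.2.2 ψ hψt e, neg_neg, real_inner_comm,
      ← integral_inner (integrable_smul_testFunction hK.2.1 hψt)]
    refine integral_congr_ae (Eventually.of_forall fun x => ?_)
    simp only [real_inner_smul_right, real_inner_comm e]
    ring
  rw [key h, key h']

theorem hasWeakGradient_weakGradient {u : 𝔼 → ℝ} (h : ∃ G, HasWeakGradient u G) :
    HasWeakGradient u (weakGradient u) := by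
  rw [weakGradient, dif_pos h]
  exact h.choose_spec

theorem HasWeakGradient.weakGradient_ae_eq {u : 𝔼 → ℝ} {G : 𝔼 → 𝔼} (h : HasWeakGradient u G) :
    weakGradient u =ᵐ[volume] G :=
  (hasWeakGradient_weakGradient ⟨G, h⟩).ae_unique h

theorem HasWeakGradient.sub {u w : 𝔼 → ℝ} {G K : 𝔼 → 𝔼} (h : HasWeakGradient u G)
    (h' : HasWeakGradient w K) : HasWeakGradient (u - w) (G - K) := by
  refine ⟨h.1.sub h'.1, h.2.1.sub h'.2.1, fun ψ hψ e => ?_⟩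
  simp only [Pi.sub_apply, sub_mul, inner_sub_left]
  rw [integral_sub (integrable_mul_fderiv_apply h.1 hψ e)
      (integrable_mul_fderiv_apply h'.1 hψ e),
    integral_sub (integrable_inner_mul_testFunction h.2.1 hψ e)
      (integrable_inner_mul_testFunction h'.2.1 hψ e), h.2.2 ψ hψ e, h'.2.2 ψ hψ e]
  ring

theorem IsTestFunction.hasWeakGradient {D : Set 𝔼} {φ : 𝔼 → ℝ} (h : IsTestFunction D φ) :
    HasWeakGradient φ (gradient φ) := by
  refine ⟨h.1.continuous.locallyIntegrable, h.continuous_gradient.locallyIntegrable,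
    fun ψ hψ e => ?_⟩
  simp only [inner_gradient_left]
  have hφ := h.1.continuous.locallyIntegrable (μ := volume)
  refine integral_mul_fderiv_eq_neg_fderiv_mul_of_integrable ?_
    (integrable_mul_fderiv_apply hφ hψ e) ?_ (fun x _ => h.differentiable x)
    (fun x _ => hψ.differentiable x)
  · exact ((h.continuous_fderiv_apply e).mul hψ.1.continuous).integrable_of_hasCompactSupport
      hψ.2.1.mul_left
  · exact (h.1.continuous.mul hψ.1.continuous).integrable_of_hasCompactSupport hψ.2.1.mul_left

theorem tendsto_eLpNorm_inner_const {α ι : Type*} [MeasurableSpace α] {μ : Measure α}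
    {l : Filter ι} {G : ι → α → 𝔼} {G₀ : α → 𝔼} {p : ℝ≥0∞}
    (h : Tendsto (fun i => eLpNorm (G i - G₀) p μ) l (𝓝 0)) (e : 𝔼) :
    Tendsto (fun i => eLpNorm ((fun x => inner ℝ (G i x) e) - fun x => inner ℝ (G₀ x) e) p μ)
      l (𝓝 0) := by
  have h2 : Tendsto (fun i => ENNReal.ofReal ‖e‖ * eLpNorm (G i - G₀) p μ) l (𝓝 0) := by
    simpa using ENNReal.Tendsto.const_mul (a := ENNReal.ofReal ‖e‖) h (Or.inr ENNReal.ofReal_ne_top)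
  refine tendsto_of_tendsto_of_tendsto_of_le_of_le tendsto_const_nhds h2 (fun _ => zero_le)
    fun i => ?_
  refine eLpNorm_le_mul_eLpNorm_of_ae_le_mul (Eventually.of_forall fun x => ?_) p
  simp only [Pi.sub_apply, ← inner_sub_left]
  rw [mul_comm]
  exact norm_inner_le_norm _ _

/-- Weak gradients pass to limits in `L^p` and `L²`. -/
theorem hasWeakGradient_of_tendsto {D : Set 𝔼} {φ : ℕ → 𝔼 → ℝ} (hφ : ∀ k, IsTestFunction D (φ k))
    {p : ℝ≥0∞} (hp : 1 ≤ p) {u : 𝔼 → ℝ} (hu : MemLp u p) {G : 𝔼 → 𝔼} (hG : MemLp G 2)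
    (hφu : Tendsto (fun k => eLpNorm (φ k - u) p) atTop (𝓝 0))
    (hφG : Tendsto (fun k => eLpNorm (gradient (φ k) - G) 2) atTop (𝓝 0)) :
    HasWeakGradient u G := by
  refine ⟨hu.locallyIntegrable hp, hG.locallyIntegrable (by norm_num), fun ψ hψ e => ?_⟩
  have : Fact (1 ≤ p) := ⟨hp⟩
  have hc : p.HolderConjugate p.conjExponent := .conjExponent hp
  have : Fact (1 ≤ p.conjExponent) := ⟨hc.symm.one_le⟩
  have h1 := tendsto_integral_mul_of_tendsto_eLpNorm (μ := volume) (p := p)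
    (q := p.conjExponent) (f := φ) (h := fun _ x => fderiv ℝ ψ x e) (l := atTop)
    (fun k => (hφ k).memLp p) hu (fun _ => hψ.memLp_fderiv_apply e _) (hψ.memLp_fderiv_apply e _)
    hφu (by simp)
  have h2 := tendsto_integral_mul_of_tendsto_eLpNorm (μ := volume) (p := 2)
    (q := 2) (f := fun k x => inner ℝ (gradient (φ k) x) e) (h := fun _ => ψ) (l := atTop)
    (fun k => ((hφ k).memLp_gradient 2).inner_const e) (hG.inner_const e)
    (fun _ => hψ.memLp _) (hψ.memLp _) (tendsto_eLpNorm_inner_const hφG e) (by simp)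
  refine tendsto_nhds_unique h1 ?_
  simp only [fun k => (hφ k).hasWeakGradient.2.2 ψ hψ e]
  exact h2.neg

theorem one_le_sobolevExp (hn : 2 < n) : 1 ≤ sobolevExp n := by
  have h : (2 : ℝ) < n := by exact_mod_cast hn
  rw [sobolevExp, ENNReal.one_le_ofReal, le_div_iff₀ (by linarith)]
  linarith

theorem sobolevExp_ne_zero (hn : 2 < n) : sobolevExp n ≠ 0 :=
  (zero_lt_one.trans_le (one_le_sobolevExp hn)).ne'

theorem sobolevExp_ne_top : sobolevExp n ≠ ⊤ := ENNReal.ofReal_ne_top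

theorem eLpNorm_two_sq {α F : Type*} [MeasurableSpace α] [NormedAddCommGroup F] {μ : Measure α}
    (f : α → F) : eLpNorm f 2 μ ^ 2 = ∫⁻ x, ‖f x‖ₑ ^ 2 ∂μ := by
  have := eLpNorm_nnreal_pow_eq_lintegral (μ := μ) (f := f) (p := 2) two_ne_zero
  simpa using this

/-! ### The nonlocal energy as an `L²` norm of increments. -/

/-- The increment `u(x) - u(y)`. -/
def jump (u : 𝔼 → ℝ) (p : 𝔼 × 𝔼) : ℝ := u p.1 - u p.2

theorem jump_sub (u w : 𝔼 → ℝ) : jump (u - w) = jump u - jump w := by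
  ext p; simp [jump]; ring

theorem jump_add (u w : 𝔼 → ℝ) : jump (u + w) = jump u + jump w := by
  ext p; simp [jump]; ring

theorem jump_smul (c : ℝ) (u : 𝔼 → ℝ) : jump (c • u) = c • jump u := by
  ext p; simp [jump]; ring

/-- The measure `C_{n,s} |x - y|^{-n-2s} dx dy` on `D_Ω`. -/
noncomputable def jumpMeasure [NeZero n] (s : ℝ) (Ω : Set 𝔼) : Measure (𝔼 × 𝔼) :=
  ENNReal.ofReal (fracConst n s) • (volume.restrict (crossDomain Ω)).withDensity
    fun p => ENNReal.ofReal (‖p.1 - p.2‖ ^ ((n : ℝ) + 2 * s))⁻¹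

theorem measurable_jumpDensity (s : ℝ) : Measurable fun p : 𝔼 × 𝔼 =>
    ENNReal.ofReal (‖p.1 - p.2‖ ^ ((n : ℝ) + 2 * s))⁻¹ := by
  fun_prop

theorem jumpMeasure_absolutelyContinuous [NeZero n] (s : ℝ) (Ω : Set 𝔼) :
    jumpMeasure s Ω ≪ volume :=
  (Measure.smul_absolutelyContinuous.trans (withDensity_absolutelyContinuous _ _)).trans
    Measure.absolutelyContinuous_restrict

/-- The weighted measure is absolutely continuous with respect to the product measure, whose null
sets contain the preimages of null sets under both projections. -/
theorem ae_jumpMeasure_of_ae [NeZero n] (s : ℝ) (Ω : Set 𝔼) {P : 𝔼 → Prop} (h : ∀ᵐ x, P x) :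
    ∀ᵐ p ∂(jumpMeasure s Ω), P p.1 ∧ P p.2 := by
  refine (jumpMeasure_absolutelyContinuous s Ω).ae_le ?_
  have h1 := (Measure.quasiMeasurePreserving_fst (μ := (volume : Measure 𝔼))
    (ν := (volume : Measure 𝔼))).ae h
  have h2 := (Measure.quasiMeasurePreserving_snd (μ := (volume : Measure 𝔼))
    (ν := (volume : Measure 𝔼))).ae h
  exact h1.and h2

theorem aestronglyMeasurable_jump [NeZero n] (s : ℝ) (Ω : Set 𝔼) {u : 𝔼 → ℝ}
    (hu : AEStronglyMeasurable u) : AEStronglyMeasurable (jump u) (jumpMeasure s Ω) := by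
  refine AEStronglyMeasurable.mono_ac (jumpMeasure_absolutelyContinuous s Ω) ?_
  exact (hu.comp_quasiMeasurePreserving (Measure.quasiMeasurePreserving_fst
    (μ := (volume : Measure 𝔼)) (ν := (volume : Measure 𝔼)))).sub
    (hu.comp_quasiMeasurePreserving (Measure.quasiMeasurePreserving_snd
    (μ := (volume : Measure 𝔼)) (ν := (volume : Measure 𝔼))))

/-- Absorbing the kernel into the measure places the nonlocal energy in a Hilbert space, where
Mazur's lemma applies. -/
theorem gagliardoSq_eq [NeZero n] (s : ℝ) (Ω : Set 𝔼) (u : 𝔼 → ℝ) :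
    gagliardoSq s Ω u = eLpNorm (jump u) 2 (jumpMeasure s Ω) ^ 2 := by
  rw [eLpNorm_two_sq, jumpMeasure, lintegral_smul_measure,
    lintegral_withDensity_eq_lintegral_mul_non_measurable _ (measurable_jumpDensity s)
      (Eventually.of_forall fun _ => ENNReal.ofReal_lt_top), gagliardoSq, smul_eq_mul]
  congr 1
  refine lintegral_congr fun p => ?_
  simp only [Pi.mul_apply, jump]
  rw [Real.enorm_eq_ofReal_abs, ← ENNReal.ofReal_pow (abs_nonneg _),
    ← ENNReal.ofReal_mul (by positivity), div_eq_inv_mul]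

theorem fracConst_nonneg [NeZero n] (s : ℝ) : 0 ≤ fracConst n s := by
  refine inv_nonneg.2 (integral_nonneg fun ζ => div_nonneg ?_ (by positivity))
  linarith [Real.cos_le_one (ζ 0)]

theorem integral_jumpMeasure [NeZero n] (s : ℝ) (Ω : Set 𝔼) (f : 𝔼 × 𝔼 → ℝ) :
    ∫ p, f p ∂(jumpMeasure s Ω) =
      fracConst n s * ∫ p in crossDomain Ω, f p / ‖p.1 - p.2‖ ^ ((n : ℝ) + 2 * s) := by
  rw [jumpMeasure, integral_smul_measure, ENNReal.toReal_ofReal (fracConst_nonneg s),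
    integral_withDensity_eq_integral_toReal_smul (measurable_jumpDensity s)
      (Eventually.of_forall fun _ => ENNReal.ofReal_lt_top), smul_eq_mul]
  congr 1
  refine integral_congr_ae (Eventually.of_forall fun p => ?_)
  simp only
  rw [ENNReal.toReal_ofReal (by positivity), smul_eq_mul, div_eq_inv_mul]

theorem energyForm_eq [NeZero n] (s : ℝ) (Ω : Set 𝔼) (u φ : 𝔼 → ℝ) :
    energyForm s Ω u φ = 1 / 2 * ∫ p, jump u p * jump φ p ∂(jumpMeasure s Ω) +
      ∫ x, inner ℝ (weakGradient u x) (weakGradient φ x) := by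
  rw [energyForm, integral_jumpMeasure]
  simp only [jump]
  ring

/-! ### Approximation in `𝒳^s(D)`. -/

section

variable [NeZero n] {s : ℝ} {Ω P₂ : Set (EuclideanSpace ℝ (Fin n))}
  {u : EuclideanSpace ℝ (Fin n) → ℝ}

theorem MemX.memLp (h : MemX s Ω P₂ u) : MemLp u (sobolevExp n) := h.1.1

theorem MemX.hasWeakGradient (h : MemX s Ω P₂ u) : HasWeakGradient u (weakGradient u) :=
  hasWeakGradient_weakGradient h.1.2.1

theorem MemX.memLp_weakGradient (h : MemX s Ω P₂ u) : MemLp (weakGradient u) 2 := h.1.2.2.1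

theorem MemX.memLp_jump (h : MemX s Ω P₂ u) : MemLp (jump u) 2 (jumpMeasure s Ω) := by
  refine ⟨aestronglyMeasurable_jump s Ω h.memLp.1, ?_⟩
  have := h.1.2.2.2
  rw [gagliardoSq_eq] at this
  exact (ENNReal.pow_lt_top_iff.1 this).resolve_right two_ne_zero

theorem tendsto_zero_of_sq_add_sq_tendsto_zero {ι : Type*} {l : Filter ι} {a b : ι → ℝ≥0∞}
    (h : Tendsto (fun i => a i ^ 2 + b i ^ 2) l (𝓝 0)) :
    Tendsto a l (𝓝 0) ∧ Tendsto b l (𝓝 0) := by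
  have key : ∀ {c : ι → ℝ≥0∞}, (∀ i, c i ^ 2 ≤ a i ^ 2 + b i ^ 2) → Tendsto c l (𝓝 0) := by
    intro c hc
    have h1 := tendsto_of_tendsto_of_tendsto_of_le_of_le tendsto_const_nhds h
      (fun _ => zero_le) hc
    have h2 := (ENNReal.continuous_rpow_const (y := 1 / 2)).tendsto (0 : ℝ≥0∞) |>.comp h1
    rw [ENNReal.zero_rpow_of_pos (by norm_num)] at h2
    refine h2.congr fun i => ?_
    simp only [Function.comp_apply]
    rw [← ENNReal.rpow_natCast, ← ENNReal.rpow_mul]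
    norm_num
  exact ⟨key fun i => le_self_add, key fun i => le_add_self⟩

theorem MemX.exists_approx (h : MemX s Ω P₂ u) :
    ∃ φ : ℕ → 𝔼 → ℝ, (∀ k, IsTestFunction (Ω ∪ P₂) (φ k)) ∧
      (∀ k, MemLp (jump (φ k)) 2 (jumpMeasure s Ω)) ∧
      Tendsto (fun k => eLpNorm (φ k - u) (sobolevExp n)) atTop (𝓝 0) ∧
      Tendsto (fun k => eLpNorm (gradient (φ k) - weakGradient u) 2) atTop (𝓝 0) ∧
      Tendsto (fun k => eLpNorm (jump (φ k) - jump u) 2 (jumpMeasure s Ω)) atTop (𝓝 0) := by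
  obtain ⟨φ, hφ, h1, h2⟩ := h.2
  have hgrad : ∀ k, eLpNorm (weakGradient (u - φ k)) 2 volume =
      eLpNorm (gradient (φ k) - weakGradient u) 2 volume := fun k => by
    rw [eLpNorm_congr_ae (h.hasWeakGradient.sub (hφ k).hasWeakGradient).weakGradient_ae_eq,
      eLpNorm_sub_comm]
  have hjump : ∀ k, eLpNorm (jump (u - φ k)) 2 (jumpMeasure s Ω) =
      eLpNorm (jump (φ k) - jump u) 2 (jumpMeasure s Ω) := fun k => by
    rw [jump_sub, eLpNorm_sub_comm]
  simp only [etaSq, gagliardoSq_eq, hgrad, hjump] at h2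
  obtain ⟨h3, h4⟩ := tendsto_zero_of_sq_add_sq_tendsto_zero h2
  -- Discarding the terms before `N` leaves increments within finite `L²` distance of those of `u`;
  -- their membership in `L²` then needs no estimate of the kernel.
  obtain ⟨N, hN⟩ := eventually_atTop.1 (h4.eventually (gt_mem_nhds zero_lt_one))
  refine ⟨fun k => φ (k + N), fun k => hφ _, fun k => ?_, ?_, ?_, ?_⟩
  · have hlt := hN (k + N) (Nat.le_add_left _ _)
    have hmem : MemLp (jump (φ (k + N)) - jump u) 2 (jumpMeasure s Ω) :=
      ⟨(aestronglyMeasurable_jump s Ω (hφ _).1.continuous.aestronglyMeasurable).sub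
        h.memLp_jump.1, hlt.trans ENNReal.one_lt_top⟩
    simpa using hmem.add h.memLp_jump
  · simp only [eLpNorm_sub_comm _ u]
    exact (tendsto_add_atTop_iff_nat N).2 h1
  · exact (tendsto_add_atTop_iff_nat N).2 h3
  · exact (tendsto_add_atTop_iff_nat N).2 h4

/-- A function in `L^{2^*}` approximated by test functions whose gradients and increments
converge belongs to `𝒳^s(D)`. -/
theorem memX_of_tendsto (hn : 2 < n) {φ : ℕ → 𝔼 → ℝ} (hφ : ∀ k, IsTestFunction (Ω ∪ P₂) (φ k))
    (hu : MemLp u (sobolevExp n)) {G : 𝔼 → 𝔼} (hG : MemLp G 2) {T : 𝔼 × 𝔼 → ℝ}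
    (hT : MemLp T 2 (jumpMeasure s Ω))
    (hφu : Tendsto (fun k => eLpNorm (φ k - u) (sobolevExp n)) atTop (𝓝 0))
    (hφG : Tendsto (fun k => eLpNorm (gradient (φ k) - G) 2) atTop (𝓝 0))
    (hφT : Tendsto (fun k => eLpNorm (jump (φ k) - T) 2 (jumpMeasure s Ω)) atTop (𝓝 0)) :
    MemX s Ω P₂ u := by
  have hw : HasWeakGradient u G := hasWeakGradient_of_tendsto hφ (one_le_sobolevExp hn) hu hG hφu hφG
  -- Two successive subsequences give almost everywhere convergence, first of the functions and then
  -- of their increments; this identifies the limits.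
  have hTu : T =ᵐ[jumpMeasure s Ω] jump u := by
    obtain ⟨a, ha, hau⟩ := (tendstoInMeasure_of_tendsto_eLpNorm (sobolevExp_ne_zero hn)
      (fun k => (hφ k).1.continuous.aestronglyMeasurable) hu.1 hφu).exists_seq_tendsto_ae
    obtain ⟨b, hb, hbT⟩ := (tendstoInMeasure_of_tendsto_eLpNorm two_ne_zero
      (fun k => aestronglyMeasurable_jump s Ω (hφ (a k)).1.continuous.aestronglyMeasurable)
      hT.1 (hφT.comp ha.tendsto_atTop)).exists_seq_tendsto_ae
    filter_upwards [hbT, ae_jumpMeasure_of_ae s Ω hau] with p hp1 hp2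
    exact tendsto_nhds_unique hp1
      ((hp2.1.comp hb.tendsto_atTop).sub (hp2.2.comp hb.tendsto_atTop))
  have hjT : ∀ k, eLpNorm (jump (u - φ k)) 2 (jumpMeasure s Ω) =
      eLpNorm (jump (φ k) - T) 2 (jumpMeasure s Ω) := fun k => by
    rw [jump_sub, eLpNorm_sub_comm]
    refine eLpNorm_congr_ae ?_
    filter_upwards [hTu] with p hp
    simp [hp]
  have hgr : ∀ k, eLpNorm (weakGradient (u - φ k)) 2 volume =
      eLpNorm (gradient (φ k) - G) 2 volume := fun k => by
    rw [eLpNorm_congr_ae (hw.sub (hφ k).hasWeakGradient).weakGradient_ae_eq, eLpNorm_sub_comm]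
  refine ⟨⟨hu, ⟨G, hw⟩, (memLp_congr_ae hw.weakGradient_ae_eq).2 hG, ?_⟩, φ, hφ, ?_, ?_⟩
  · rw [gagliardoSq_eq, ← eLpNorm_congr_ae hTu]
    exact ENNReal.pow_lt_top hT.2
  · simpa only [eLpNorm_sub_comm u] using hφu
  · simp only [etaSq, gagliardoSq_eq, hjT, hgr]
    simpa using (ENNReal.Tendsto.pow (n := 2) hφG).add (ENNReal.Tendsto.pow (n := 2) hφT)

end

/-! ### Stability of `𝒳^s(D)` under Lipschitz maps. -/

theorem norm_gradient (φ : 𝔼 → ℝ) (x : 𝔼) : ‖gradient φ x‖ = ‖fderiv ℝ φ x‖ := by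
  rw [gradient, LinearIsometryEquiv.norm_map]

theorem norm_apply_pair_sub_le {F : ℝ × ℝ → ℝ} {L : NNReal} (hF : LipschitzWith L F)
    (z w : ℝ × ℝ) : ‖F z - F w‖ ≤ L * (‖z.1 - w.1‖ + ‖z.2 - w.2‖) := by
  rw [← dist_eq_norm]
  refine (hF.dist_le_mul z w).trans ?_
  gcongr
  rw [Prod.dist_eq, dist_eq_norm, dist_eq_norm]
  exact max_le (le_add_of_nonneg_right (norm_nonneg _)) (le_add_of_nonneg_left (norm_nonneg _))

/-- A Lipschitz function of two test functions is close to a test function with controlled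
gradient and increments. -/
theorem exists_isTestFunction_eLpNorm_sub_le {D : Set 𝔼} {φ χ : 𝔼 → ℝ} (hφ : IsTestFunction D φ)
    (hχ : IsTestFunction D χ) {F : ℝ × ℝ → ℝ} {L : NNReal} (hF : LipschitzWith L F)
    (hF0 : F 0 = 0) {p : ℝ≥0∞} (hp : p ≠ 0) (hp' : p ≠ ⊤) {ε : ℝ} (hε : 0 < ε) :
    ∃ ψ, IsTestFunction D ψ ∧ eLpNorm (ψ - fun x => F (φ x, χ x)) p ≤ ENNReal.ofReal ε ∧
      (∀ z, ‖jump ψ z‖ ≤ L * (‖jump φ z‖ + ‖jump χ z‖)) ∧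
      ∀ x, ‖gradient ψ x‖ ≤ L * (‖gradient φ x‖ + ‖gradient χ x‖) := by
  set K := tsupport φ ∪ tsupport χ with hK
  have hKc : IsCompact K := hφ.2.1.isCompact.union hχ.2.1.isCompact
  have hKm : MeasurableSet K := hKc.measurableSet
  -- `m` is the `L^p` norm of the indicator of `K`, so uniform accuracy `ε / (m + 1)` on `K` gives
  -- `ε` in `L^p`; the `+ 1` covers `m = 0`.
  set m : ℝ := (volume K ^ (1 / p.toReal)).toReal with hm
  have hm0 : 0 ≤ m := ENNReal.toReal_nonneg
  obtain ⟨G, hG, hGL, hG0, hGF⟩ := hF.exists_contDiff_dist_le hF0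
    (δ := ε / (m + 1)) (by positivity)
  have hzero : ∀ x ∉ K, φ x = 0 ∧ χ x = 0 := fun x hx =>
    ⟨image_eq_zero_of_notMem_tsupport fun h => hx (Or.inl h),
      image_eq_zero_of_notMem_tsupport fun h => hx (Or.inr h)⟩
  have hsupp : Function.support (fun x => G (φ x, χ x)) ⊆ K := by
    intro x hx
    by_contra hxK
    obtain ⟨h1, h2⟩ := hzero x hxK
    exact hx (by simp only [h1, h2]; exact hG0)
  have htsupp : tsupport (fun x => G (φ x, χ x)) ⊆ K := closure_minimal hsupp hKc.isClosed
  refine ⟨fun x => G (φ x, χ x), ⟨hG.comp (hφ.1.prodMk hχ.1),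
    hKc.of_isClosed_subset (isClosed_tsupport _) htsupp,
    htsupp.trans (union_subset hφ.2.2 hχ.2.2)⟩, ?_,
    fun z => norm_apply_pair_sub_le hGL (φ z.1, χ z.1) (φ z.2, χ z.2), fun x => ?_⟩
  · have h1 : eLpNorm ((fun x => G (φ x, χ x)) - fun x => F (φ x, χ x)) p volume ≤
        eLpNorm (K.indicator fun _ => ε / (m + 1)) p volume := by
      refine eLpNorm_mono_real fun x => ?_
      by_cases hx : x ∈ K
      · rw [indicator_of_mem hx]
        exact hGF _
      · obtain ⟨h1, h2⟩ := hzero x hx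
        have h3 : ((0 : ℝ), (0 : ℝ)) = 0 := rfl
        simp [h1, h2, h3, hG0, hF0, hx]
    refine h1.trans ?_
    rw [eLpNorm_indicator_const hKm hp hp', Real.enorm_of_nonneg (by positivity),
      ← ENNReal.ofReal_toReal (ENNReal.rpow_ne_top_of_nonneg (by positivity) hKc.measure_lt_top.ne),
      ← hm, ← ENNReal.ofReal_mul (by positivity)]
    refine ENNReal.ofReal_le_ofReal ?_
    rw [div_mul_eq_mul_div, div_le_iff₀ (by positivity)]
    nlinarith
  · have hd : HasFDerivAt (fun x => G (φ x, χ x))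
        ((fderiv ℝ G (φ x, χ x)).comp ((fderiv ℝ φ x).prod (fderiv ℝ χ x))) x :=
      ((hG.differentiable (by simp) (φ x, χ x)).hasFDerivAt).comp x
        ((hφ.differentiable x).hasFDerivAt.prodMk (hχ.differentiable x).hasFDerivAt)
    rw [norm_gradient, norm_gradient, norm_gradient, hd.fderiv]
    refine (ContinuousLinearMap.opNorm_comp_le _ _).trans ?_
    refine mul_le_mul (norm_fderiv_le_of_lipschitz ℝ hGL) ?_ (norm_nonneg _) L.2
    rw [ContinuousLinearMap.opNorm_prod, Prod.norm_def]
    exact max_le (le_add_of_nonneg_right (norm_nonneg _)) (le_add_of_nonneg_left (norm_nonneg _))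

/-- The triples (gradient, increment, function) of test functions with finite energy, as a subspace
of `(L² × L²) × L^p`. -/
noncomputable def testTriples [NeZero n] (s : ℝ) (Ω D : Set 𝔼) (p : ℝ≥0∞) [Fact (1 ≤ p)] :
    Submodule ℝ (WithLp 2 (Lp 𝔼 2 (volume : Measure 𝔼) × Lp ℝ 2 (jumpMeasure s Ω)) ×
      Lp ℝ p (volume : Measure 𝔼)) where
  carrier := {z | ∃ ψ, IsTestFunction D ψ ∧ z.1.fst =ᵐ[volume] gradient ψ ∧
    z.1.snd =ᵐ[jumpMeasure s Ω] jump ψ ∧ z.2 =ᵐ[volume] ψ}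
  zero_mem' := by
    refine ⟨0, isTestFunction_zero D, ?_, ?_, Lp.coeFn_zero _ _ _⟩
    · refine (Lp.coeFn_zero _ _ _).trans (Eventually.of_forall fun x => ?_)
      simp [gradient]
    · refine (Lp.coeFn_zero _ _ _).trans (Eventually.of_forall fun x => ?_)
      simp [jump]
  add_mem' := by
    rintro z w ⟨ψ, h, h1, h2, h3⟩ ⟨χ, h', h1', h2', h3'⟩
    refine ⟨ψ + χ, h.add h', ?_, ?_, ?_⟩
    · rw [h.gradient_add h']
      exact (Lp.coeFn_add _ _).trans (h1.add h1')
    · rw [jump_add]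
      exact (Lp.coeFn_add _ _).trans (h2.add h2')
    · exact (Lp.coeFn_add _ _).trans (h3.add h3')
  smul_mem' := by
    rintro c z ⟨ψ, h, h1, h2, h3⟩
    refine ⟨c • ψ, h.smul c, ?_, ?_, ?_⟩
    · rw [h.gradient_smul]
      exact (Lp.coeFn_smul _ _).trans (h1.const_smul c)
    · rw [jump_smul]
      exact (Lp.coeFn_smul _ _).trans (h2.const_smul c)
    · exact (Lp.coeFn_smul _ _).trans (h3.const_smul c)

section

variable [NeZero n] {s : ℝ} {Ω P₂ : Set (EuclideanSpace ℝ (Fin n))}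
  {u v : EuclideanSpace ℝ (Fin n) → ℝ}

/-- `𝒳^s(D)` contains the `L^{2^*}` limits of energy bounded sequences of test functions. -/
theorem memX_of_tendsto_of_bounded (hn : 2 < n) {ψ : ℕ → 𝔼 → ℝ}
    (hψ : ∀ k, IsTestFunction (Ω ∪ P₂) (ψ k)) (hu : MemLp u (sobolevExp n))
    (hlim : Tendsto (fun k => eLpNorm (ψ k - u) (sobolevExp n)) atTop (𝓝 0)) {A B : ℝ≥0∞}
    (hA : A ≠ ⊤) (hB : B ≠ ⊤) (hgrad : ∀ k, eLpNorm (gradient (ψ k)) 2 ≤ A)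
    (hjump : ∀ k, eLpNorm (jump (ψ k)) 2 (jumpMeasure s Ω) ≤ B) : MemX s Ω P₂ u := by
  have : Fact (1 ≤ sobolevExp n) := ⟨one_le_sobolevExp hn⟩
  have hj : ∀ k, MemLp (jump (ψ k)) 2 (jumpMeasure s Ω) := fun k =>
    ⟨aestronglyMeasurable_jump s Ω (hψ k).1.continuous.aestronglyMeasurable,
      (hjump k).trans_lt hB.lt_top⟩
  have hg : ∀ k, MemLp (gradient (ψ k)) 2 := fun k => (hψ k).memLp_gradient 2
  have hp : ∀ k, MemLp (ψ k) (sobolevExp n) := fun k => (hψ k).memLp _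
  -- Gradients and increments are only bounded, and sit in the Hilbert factor; the functions
  -- converge strongly in `L^{2^*}`. Convex combinations of test functions are again test functions.
  obtain ⟨x₀, hx₀⟩ := exists_mk_mem_closure_of_bounded_fst
    (testTriples s Ω (Ω ∪ P₂) (sobolevExp n))
    (fun k => WithLp.toLp 2 ((hg k).toLp _, (hj k).toLp _)) (fun k => (hp k).toLp _)
    (fun k => ⟨ψ k, hψ k, (hg k).coeFn_toLp, (hj k).coeFn_toLp, (hp k).coeFn_toLp⟩)
    (R := Real.sqrt (A.toReal ^ 2 + B.toReal ^ 2)) (fun k => by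
      rw [WithLp.prod_norm_eq_of_L2]
      refine Real.sqrt_le_sqrt ?_
      gcongr
      · exact (Lp.norm_toLp _ (hg k)).trans_le (ENNReal.toReal_mono hA (hgrad k))
      · exact (Lp.norm_toLp _ (hj k)).trans_le (ENNReal.toReal_mono hB (hjump k)))
    (w₀ := hu.toLp u) ((Lp.tendsto_Lp_iff_tendsto_eLpNorm'' ψ hp u hu).2 hlim)
  obtain ⟨z, hz, hzlim⟩ := mem_closure_iff_seq_limit.1 hx₀
  choose χ hχ h1 h2 h3 using hz
  have hz2 : Tendsto (fun k => (z k).2) atTop (𝓝 (hu.toLp u)) :=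
    (continuous_snd.tendsto _).comp hzlim
  have hz1 : Tendsto (fun k => (z k).1) atTop (𝓝 x₀) := (continuous_fst.tendsto _).comp hzlim
  have hz1' := ((WithLp.prod_continuous_ofLp 2 _ _).tendsto x₀).comp hz1
  have hz11 : Tendsto (fun k => (z k).1.fst) atTop (𝓝 x₀.fst) :=
    (continuous_fst.tendsto _).comp hz1'
  have hz12 : Tendsto (fun k => (z k).1.snd) atTop (𝓝 x₀.snd) :=
    (continuous_snd.tendsto _).comp hz1'
  refine memX_of_tendsto hn hχ hu (Lp.memLp x₀.fst) (Lp.memLp x₀.snd) ?_ ?_ ?_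
  · refine ((Lp.tendsto_Lp_iff_tendsto_eLpNorm' _ _).1 hz2).congr fun k => eLpNorm_congr_ae ?_
    exact (h3 k).sub hu.coeFn_toLp
  · refine ((Lp.tendsto_Lp_iff_tendsto_eLpNorm' _ _).1 hz11).congr fun k => eLpNorm_congr_ae ?_
    exact (h1 k).sub (ae_eq_refl _)
  · refine ((Lp.tendsto_Lp_iff_tendsto_eLpNorm' _ _).1 hz12).congr fun k => eLpNorm_congr_ae ?_
    exact (h2 k).sub (ae_eq_refl _)

/-- `𝒳^s(D)` is stable under Lipschitz functions of two variables vanishing at `0`. -/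
theorem MemX.comp_lipschitz (hn : 2 < n) (hu : MemX s Ω P₂ u) (hv : MemX s Ω P₂ v)
    {F : ℝ × ℝ → ℝ} {L : NNReal} (hF : LipschitzWith L F) (hF0 : F 0 = 0) :
    MemX s Ω P₂ fun x => F (u x, v x) := by
  have hp := one_le_sobolevExp hn
  obtain ⟨φ, hφ, hφj, hφu, hφG, hφT⟩ := hu.exists_approx
  obtain ⟨χ, hχ, hχj, hχv, hχG, hχT⟩ := hv.exists_approx
  -- The `ψ k` approximate `F (φ k, χ k)` in `L^{2^*}`. Their gradients need not converge, but the
  -- Lipschitz bound keeps their energies bounded.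
  choose ψ hψ hψF hψj hψg using fun k : ℕ => exists_isTestFunction_eLpNorm_sub_le (hφ k) (hχ k)
    hF hF0 (sobolevExp_ne_zero hn) sobolevExp_ne_top (Nat.one_div_pos_of_nat (α := ℝ) (n := k))
  obtain ⟨M₁, hM₁⟩ := exists_eLpNorm_le_of_tendsto (fun k => (hφ k).memLp_gradient 2)
    hu.memLp_weakGradient hφG
  obtain ⟨M₂, hM₂⟩ := exists_eLpNorm_le_of_tendsto (fun k => (hχ k).memLp_gradient 2)
    hv.memLp_weakGradient hχG
  obtain ⟨N₁, hN₁⟩ := exists_eLpNorm_le_of_tendsto hφj hu.memLp_jump hφT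
  obtain ⟨N₂, hN₂⟩ := exists_eLpNorm_le_of_tendsto hχj hv.memLp_jump hχT
  have hFuv : AEStronglyMeasurable (fun x => F (u x, v x)) :=
    hF.continuous.comp_aestronglyMeasurable (hu.memLp.1.prodMk hv.memLp.1)
  have hmem : MemLp (fun x => F (u x, v x)) (sobolevExp n) := by
    refine ⟨hFuv, (eLpNorm_le_mul_add_of_norm_le hp hu.memLp.1 hv.memLp.1 (L := L)
      fun x => ?_).trans_lt (ENNReal.mul_lt_top ENNReal.ofReal_lt_top
        (ENNReal.add_lt_top.2 ⟨hu.memLp.2, hv.memLp.2⟩))⟩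
    simpa [hF0] using norm_apply_pair_sub_le hF (u x, v x) 0
  refine memX_of_tendsto_of_bounded hn hψ hmem ?_
    (A := ENNReal.ofReal L * (ENNReal.ofReal M₁ + ENNReal.ofReal M₂))
    (B := ENNReal.ofReal L * (ENNReal.ofReal N₁ + ENNReal.ofReal N₂))
    (by finiteness) (by finiteness) (fun k => ?_) (fun k => ?_)
  · have hbound : ∀ k, eLpNorm (ψ k - fun x => F (u x, v x)) (sobolevExp n) volume ≤
        ENNReal.ofReal (1 / ((k : ℝ) + 1)) + ENNReal.ofReal L *
          (eLpNorm (φ k - u) (sobolevExp n) volume + eLpNorm (χ k - v) (sobolevExp n) volume) := by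
      intro k
      have hFk : Continuous fun x => F (φ k x, χ k x) :=
        hF.continuous.comp ((hφ k).1.continuous.prodMk (hχ k).1.continuous)
      have h1 : ψ k - (fun x => F (u x, v x)) = (ψ k - fun x => F (φ k x, χ k x)) +
          ((fun x => F (φ k x, χ k x)) - fun x => F (u x, v x)) := by abel
      rw [h1]
      refine (eLpNorm_add_le ((hψ k).1.continuous.sub hFk).aestronglyMeasurable
        (hFk.aestronglyMeasurable.sub hFuv) hp).trans (add_le_add (hψF k) ?_)
      exact eLpNorm_le_mul_add_of_norm_le hp
        ((hφ k).1.continuous.aestronglyMeasurable.sub hu.memLp.1)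
        ((hχ k).1.continuous.aestronglyMeasurable.sub hv.memLp.1)
        fun x => norm_apply_pair_sub_le hF (φ k x, χ k x) (u x, v x)
    refine tendsto_of_tendsto_of_tendsto_of_le_of_le tendsto_const_nhds ?_ (fun _ => zero_le)
      hbound
    have h1 := ENNReal.tendsto_ofReal (tendsto_one_div_add_atTop_nhds_zero_nat (𝕜 := ℝ))
    have h2 := h1.add (ENNReal.Tendsto.const_mul (a := ENNReal.ofReal L) (hφu.add hχv)
      (Or.inr ENNReal.ofReal_ne_top))
    simpa using h2
  · refine (eLpNorm_le_mul_add_of_norm_le (by norm_num)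
      ((hφ k).memLp_gradient 2).1 ((hχ k).memLp_gradient 2).1 (hψg k)).trans ?_
    gcongr
    · exact hM₁ k
    · exact hM₂ k
  · refine (eLpNorm_le_mul_add_of_norm_le (by norm_num) (hφj k).1 (hχj k).1 (hψj k)).trans ?_
    gcongr
    · exact hN₁ k
    · exact hN₂ k

end

/-! ### Difference quotients and the passage from increments to gradients. -/

/-- The difference quotient of `u` with step `t` in direction `e`. -/
noncomputable def diffQuot (t : ℝ) (e : 𝔼) (u : 𝔼 → ℝ) (x : 𝔼) : ℝ := t⁻¹ * (u (x + t • e) - u x)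

theorem diffQuot_sub (t : ℝ) (e : 𝔼) (u w : 𝔼 → ℝ) :
    diffQuot t e (u - w) = diffQuot t e u - diffQuot t e w := by
  ext x; simp [diffQuot]; ring

theorem aestronglyMeasurable_diffQuot (t : ℝ) (e : 𝔼) {u : 𝔼 → ℝ} (hu : AEStronglyMeasurable u) :
    AEStronglyMeasurable (diffQuot t e u) :=
  ((hu.comp_measurePreserving (measurePreserving_add_right volume (t • e))).sub hu).const_mul t⁻¹

theorem IsTestFunction.diffQuot_eq_integral {D : Set 𝔼} {φ : 𝔼 → ℝ} (h : IsTestFunction D φ)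
    {t : ℝ} (ht : t ≠ 0) (e x : 𝔼) :
    diffQuot t e φ x = ∫ r in (0 : ℝ)..1, fderiv ℝ φ (x + (r * t) • e) e := by
  have hd : ∀ r : ℝ, HasDerivAt (fun r : ℝ => t⁻¹ * φ (x + (r * t) • e))
      (fderiv ℝ φ (x + (r * t) • e) e) r := by
    intro r
    have h1 : HasDerivAt (fun r : ℝ => x + (r * t) • e) (t • e) r := by
      simpa using (((hasDerivAt_id r).mul_const t).smul_const e).const_add x
    have h2 := ((h.differentiable (x + (r * t) • e)).hasFDerivAt.comp_hasDerivAt r h1).const_mul t⁻¹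
    rw [map_smul, smul_eq_mul, inv_mul_cancel_left₀ ht] at h2
    exact h2
  have hc : Continuous fun r : ℝ => fderiv ℝ φ (x + (r * t) • e) e :=
    (h.continuous_fderiv_apply e).comp (by fun_prop)
  rw [intervalIntegral.integral_eq_sub_of_hasDerivAt (fun r _ => hd r)
    (hc.intervalIntegrable _ _)]
  simp [diffQuot, mul_sub]

/-- The quotient is the average of the directional derivative along a segment. Jensen, Tonelli and
translation invariance give a bound independent of `t`. -/
theorem IsTestFunction.eLpNorm_diffQuot_le {D : Set 𝔼} {φ : 𝔼 → ℝ} (h : IsTestFunction D φ)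
    {t : ℝ} (ht : t ≠ 0) (e : 𝔼) :
    eLpNorm (diffQuot t e φ) 2 ≤ eLpNorm (fun x => fderiv ℝ φ x e) 2 := by
  set ν : Measure ℝ := volume.restrict (Ioc 0 1) with hν
  have : IsProbabilityMeasure ν := ⟨by simp [hν]⟩
  have hc : Continuous fun z : 𝔼 × ℝ => fderiv ℝ φ (z.1 + (z.2 * t) • e) e :=
    (h.continuous_fderiv_apply e).comp (by fun_prop)
  refine le_of_not_gt fun hlt => (ENNReal.pow_lt_pow_left two_ne_zero hlt).not_ge ?_
  rw [eLpNorm_two_sq, eLpNorm_two_sq]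
  calc ∫⁻ x, ‖diffQuot t e φ x‖ₑ ^ 2
      ≤ ∫⁻ x, ∫⁻ r, ‖fderiv ℝ φ (x + (r * t) • e) e‖ₑ ^ 2 ∂ν := by
        refine lintegral_mono fun x => ?_
        rw [h.diffQuot_eq_integral ht, intervalIntegral.integral_of_le zero_le_one]
        have hcx : Continuous fun r : ℝ => fderiv ℝ φ (x + (r * t) • e) e :=
          hc.comp (by fun_prop : Continuous fun r : ℝ => (x, r))
        have h1 := eLpNorm_le_eLpNorm_of_exponent_le (μ := ν) (p := 1) (q := 2) (by norm_num)
          hcx.aestronglyMeasurable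
        rw [eLpNorm_one_eq_lintegral_enorm] at h1
        rw [← eLpNorm_two_sq]
        gcongr
        exact (enorm_integral_le_lintegral_enorm _).trans h1
    _ = ∫⁻ r, ∫⁻ x, ‖fderiv ℝ φ (x + (r * t) • e) e‖ₑ ^ 2 ∂volume ∂ν :=
        lintegral_lintegral_swap (hc.enorm.measurable.pow_const 2).aemeasurable
    _ = ∫⁻ r, ∫⁻ x, ‖fderiv ℝ φ x e‖ₑ ^ 2 ∂volume ∂ν := by
        refine lintegral_congr fun r => ?_
        exact lintegral_add_right_eq_self (fun x => ‖fderiv ℝ φ x e‖ₑ ^ 2) ((r * t) • e)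
    _ = ∫⁻ x, ‖fderiv ℝ φ x e‖ₑ ^ 2 := by simp

theorem tendsto_diffQuot_of_differentiableAt {φ : 𝔼 → ℝ} {x : 𝔼} (h : DifferentiableAt ℝ φ x)
    (e : 𝔼) {t : ℕ → ℝ} (ht : ∀ j, t j ≠ 0) (htl : Tendsto t atTop (𝓝 0)) :
    Tendsto (fun j => diffQuot (t j) e φ x) atTop (𝓝 (fderiv ℝ φ x e)) := by
  have h1 := h.hasFDerivAt.hasLineDerivAt e
  have h2 := hasDerivAt_iff_tendsto_slope_zero.1 h1
  have h3 := h2.comp (tendsto_nhdsWithin_iff.2 ⟨htl, Eventually.of_forall ht⟩)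
  refine h3.congr fun j => ?_
  simp [diffQuot]

/-- Dominated convergence: for `|t| ≤ 1` all quotients vanish outside one ball and are bounded there
by the Lipschitz constant times `‖e‖`. -/
theorem IsTestFunction.tendsto_eLpNorm_diffQuot {D : Set 𝔼} {φ : 𝔼 → ℝ} (h : IsTestFunction D φ)
    (e : 𝔼) {t : ℕ → ℝ} (ht : ∀ j, t j ≠ 0) (ht1 : ∀ j, |t j| ≤ 1) (htl : Tendsto t atTop (𝓝 0)) :
    Tendsto (fun j => eLpNorm (diffQuot (t j) e φ - fun x => fderiv ℝ φ x e) 2) atTop (𝓝 0) := by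
  obtain ⟨C, hC⟩ := h.1.lipschitzWith_of_hasCompactSupport h.2.1 (by simp)
  obtain ⟨R, hR⟩ := h.2.1.isCompact.isBounded.subset_closedBall (0 : 𝔼)
  set K := Metric.closedBall (0 : 𝔼) (R + ‖e‖) with hK
  have hout : ∀ x, R < ‖x‖ → φ x = 0 := fun x hx =>
    image_eq_zero_of_notMem_tsupport fun hx' => by
      have := hR hx'
      rw [mem_closedBall_zero_iff] at this
      linarith
  have hbound : ∀ j x, ‖diffQuot (t j) e φ x - fderiv ℝ φ x e‖ ≤
      K.indicator (fun _ => 2 * (C * ‖e‖)) x := by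
    intro j x
    by_cases hx : x ∈ K
    · rw [indicator_of_mem hx, two_mul]
      refine (norm_sub_le _ _).trans (add_le_add ?_ ?_)
      · rw [diffQuot, norm_mul, norm_inv, inv_mul_le_iff₀ (norm_pos_iff.2 (ht j))]
        have := hC.dist_le_mul (x + t j • e) x
        rw [dist_eq_norm, dist_self_add_left, norm_smul] at this
        linarith
      · refine ((fderiv ℝ φ x).le_opNorm e).trans ?_
        gcongr
        exact norm_fderiv_le_of_lipschitz ℝ hC
    · have hx' : R + ‖e‖ < ‖x‖ := by
        rw [hK, mem_closedBall_zero_iff] at hx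
        linarith
      have hte : ‖t j • e‖ ≤ ‖e‖ := by
        rw [norm_smul]
        exact mul_le_of_le_one_left (norm_nonneg _) (ht1 j)
      have h1 : φ x = 0 := hout x (by linarith [norm_nonneg e])
      have h2 : φ (x + t j • e) = 0 := hout _ (by
        have := norm_sub_le (x + t j • e) (t j • e)
        rw [add_sub_cancel_right] at this
        linarith)
      have h3 : fderiv ℝ φ x = 0 := by
        by_contra hne
        have hmem : x ∈ tsupport φ := support_fderiv_subset ℝ hne
        have := hR hmem
        rw [mem_closedBall_zero_iff] at this
        linarith [norm_nonneg e]
      simp [diffQuot, h1, h2, h3, hx]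
  have hlim : Tendsto (fun j => ∫⁻ x, ‖diffQuot (t j) e φ x - fderiv ℝ φ x e‖ₑ ^ 2) atTop
      (𝓝 (∫⁻ _ : 𝔼, 0)) := by
    refine tendsto_lintegral_of_dominated_convergence'
      (fun x => ‖K.indicator (fun _ => 2 * (C * ‖e‖)) x‖ₑ ^ 2) (fun j => ?_)
      (fun j => Eventually.of_forall fun x => ?_) ?_ (Eventually.of_forall fun x => ?_)
    · exact (((aestronglyMeasurable_diffQuot (t j) e h.1.continuous.aestronglyMeasurable).sub
        (h.continuous_fderiv_apply e).aestronglyMeasurable).enorm).pow_const 2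
    · exact pow_le_pow_left' (enorm_le_iff_norm_le.2 ((hbound j x).trans (le_abs_self _))) 2
    · rw [← eLpNorm_two_sq]
      refine (ENNReal.pow_lt_top (memLp_indicator_const 2 measurableSet_closedBall _
        (Or.inr ?_)).2).ne
      exact measure_closedBall_lt_top.ne
    · have h1 := (tendsto_diffQuot_of_differentiableAt (h.differentiable x) e ht htl).sub_const
        (fderiv ℝ φ x e)
      rw [sub_self] at h1
      simpa using ENNReal.Tendsto.pow (n := 2) h1.enorm
  simp only [lintegral_zero] at hlim
  refine (tendsto_zero_of_sq_add_sq_tendsto_zero (b := fun _ => 0) ?_).1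
  simpa [eLpNorm_two_sq] using hlim

/-- Fatou's lemma along an almost everywhere convergent subsequence carries over the uniform bound
for test functions. -/
theorem eLpNorm_diffQuot_le_of_tendsto {D : Set 𝔼} {φ : ℕ → 𝔼 → ℝ}
    (hφ : ∀ k, IsTestFunction D (φ k)) {p : ℝ≥0∞} (hp : p ≠ 0) {u : 𝔼 → ℝ}
    (hu : AEStronglyMeasurable u) {G : 𝔼 → 𝔼} (hG : AEStronglyMeasurable G)
    (hφu : Tendsto (fun k => eLpNorm (φ k - u) p) atTop (𝓝 0))
    (hφG : Tendsto (fun k => eLpNorm (gradient (φ k) - G) 2) atTop (𝓝 0)) {t : ℝ} (ht : t ≠ 0)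
    (e : 𝔼) : eLpNorm (diffQuot t e u) 2 ≤ ENNReal.ofReal ‖e‖ * eLpNorm G 2 := by
  obtain ⟨a, ha, hau⟩ := (tendstoInMeasure_of_tendsto_eLpNorm hp
    (fun k => (hφ k).1.continuous.aestronglyMeasurable) hu hφu).exists_seq_tendsto_ae
  have hdq : ∀ᵐ x, Tendsto (fun j => diffQuot t e (φ (a j)) x) atTop (𝓝 (diffQuot t e u x)) := by
    filter_upwards [hau, (measurePreserving_add_right volume (t • e)).quasiMeasurePreserving.ae hau]
      with x h1 h2
    exact (h2.sub h1).const_mul _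
  have hb : ∀ k, eLpNorm (diffQuot t e (φ k)) 2 volume ≤
      ENNReal.ofReal ‖e‖ * (eLpNorm (gradient (φ k) - G) 2 volume + eLpNorm G 2 volume) := by
    intro k
    refine ((hφ k).eLpNorm_diffQuot_le ht e).trans
      (eLpNorm_le_mul_add_of_norm_le (by norm_num)
        ((hφ k).continuous_gradient.aestronglyMeasurable.sub hG) hG fun x => ?_)
    rw [← inner_gradient_left, mul_comm]
    refine (norm_inner_le_norm _ _).trans ?_
    gcongr
    simpa using norm_add_le (gradient (φ k) x - G x) (G x)
  have hlim : Tendsto (fun j => ENNReal.ofReal ‖e‖ *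
      (eLpNorm (gradient (φ (a j)) - G) 2 volume + eLpNorm G 2 volume)) atTop
      (𝓝 (ENNReal.ofReal ‖e‖ * eLpNorm G 2 volume)) := by
    have := ENNReal.Tendsto.const_mul (a := ENNReal.ofReal ‖e‖)
      ((hφG.comp ha.tendsto_atTop).add (tendsto_const_nhds (x := eLpNorm G 2 volume)))
      (Or.inr ENNReal.ofReal_ne_top)
    simpa using this
  calc eLpNorm (diffQuot t e u) 2 volume
      ≤ atTop.liminf fun j => eLpNorm (diffQuot t e (φ (a j))) 2 volume :=
        Lp.eLpNorm_lim_le_liminf_eLpNorm (fun j => aestronglyMeasurable_diffQuot t e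
          (hφ _).1.continuous.aestronglyMeasurable) _ hdq
    _ ≤ atTop.liminf fun j => ENNReal.ofReal ‖e‖ *
          (eLpNorm (gradient (φ (a j)) - G) 2 volume + eLpNorm G 2 volume) :=
        liminf_le_liminf (Eventually.of_forall fun j => hb (a j))
    _ = _ := hlim.liminf_eq

theorem integral_inner_eq_sum {G H : 𝔼 → 𝔼} (hG : MemLp G 2) (hH : MemLp H 2) :
    ∫ x, inner ℝ (G x) (H x) = ∑ i, ∫ x, inner ℝ (G x) (EuclideanSpace.basisFun (Fin n) ℝ i) *
      inner ℝ (H x) (EuclideanSpace.basisFun (Fin n) ℝ i) := by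
  rw [← integral_finsetSum]
  · refine integral_congr_ae (Eventually.of_forall fun x => ?_)
    simp only
    rw [← (EuclideanSpace.basisFun (Fin n) ℝ).sum_inner_mul_inner (G x) (H x)]
    refine Finset.sum_congr rfl fun i _ => ?_
    rw [real_inner_comm (H x)]
  · exact fun i _ => (hG.inner_const _).integrable_mul (hH.inner_const _)

section

variable [NeZero n] {s : ℝ} {Ω P₂ : Set (EuclideanSpace ℝ (Fin n))}
  {u v : EuclideanSpace ℝ (Fin n) → ℝ}

theorem MemX.memLp_diffQuot (hn : 2 < n) (hu : MemX s Ω P₂ u) {t : ℝ} (ht : t ≠ 0) (e : 𝔼) :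
    MemLp (diffQuot t e u) 2 := by
  obtain ⟨φ, hφ, -, hφu, hφG, -⟩ := hu.exists_approx
  exact ⟨aestronglyMeasurable_diffQuot t e hu.memLp.1,
    (eLpNorm_diffQuot_le_of_tendsto hφ (sobolevExp_ne_zero hn) hu.memLp.1
      hu.memLp_weakGradient.1 hφu hφG ht e).trans_lt
        (ENNReal.mul_lt_top ENNReal.ofReal_lt_top hu.memLp_weakGradient.2)⟩

/-- Difference quotients of functions in `𝒳^s(D)` converge in `L²` to directional derivatives. -/
theorem MemX.tendsto_eLpNorm_diffQuot (hn : 2 < n) (hu : MemX s Ω P₂ u) (e : 𝔼) {t : ℕ → ℝ}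
    (ht : ∀ j, t j ≠ 0) (ht1 : ∀ j, |t j| ≤ 1) (htl : Tendsto t atTop (𝓝 0)) :
    Tendsto (fun j => eLpNorm (diffQuot (t j) e u - fun x => inner ℝ (weakGradient u x) e) 2)
      atTop (𝓝 0) := by
  obtain ⟨φ, hφ, -, hφu, hφG, -⟩ := hu.exists_approx
  set η : ℕ → ℝ≥0∞ := fun k => eLpNorm (gradient (φ k) - weakGradient u) 2 volume with hη
  have h1 : ∀ k j, eLpNorm (diffQuot (t j) e u - diffQuot (t j) e (φ k)) 2 volume ≤
      ENNReal.ofReal ‖e‖ * η k := by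
    intro k j
    rw [← diffQuot_sub, show η k = _ from eLpNorm_sub_comm _ _ _ _]
    -- With `k` fixed, `φ i - φ k` approximates `u - φ k`, so the quotients of the error are bounded
    -- uniformly in `j`.
    refine eLpNorm_diffQuot_le_of_tendsto (φ := fun i => φ i - φ k)
      (fun i => (hφ i).sub (hφ k)) (sobolevExp_ne_zero hn)
      (hu.memLp.1.sub (hφ k).1.continuous.aestronglyMeasurable)
      (hu.memLp_weakGradient.1.sub (hφ k).continuous_gradient.aestronglyMeasurable) ?_ ?_ (ht j) e
    · simpa using hφu
    · simp only [fun i => (hφ i).gradient_sub (hφ k)]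
      simpa using hφG
  have h3 : ∀ k, eLpNorm ((fun x => fderiv ℝ (φ k) x e) - fun x => inner ℝ (weakGradient u x) e) 2
      volume ≤ ENNReal.ofReal ‖e‖ * η k := by
    intro k
    refine eLpNorm_le_mul_eLpNorm_of_ae_le_mul (Eventually.of_forall fun x => ?_) 2
    simp only [Pi.sub_apply, ← inner_gradient_left, ← inner_sub_left]
    rw [mul_comm]
    exact norm_inner_le_norm _ _
  have htri : ∀ k j, eLpNorm (diffQuot (t j) e u - fun x => inner ℝ (weakGradient u x) e) 2
      volume ≤ 2 * (ENNReal.ofReal ‖e‖ * η k) +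
        eLpNorm (diffQuot (t j) e (φ k) - fun x => fderiv ℝ (φ k) x e) 2 volume := by
    intro k j
    have hφm := (hφ k).1.continuous.aestronglyMeasurable (μ := volume)
    have hdm := ((hφ k).continuous_fderiv_apply e).aestronglyMeasurable (μ := volume)
    have hum := aestronglyMeasurable_diffQuot (t j) e hu.memLp.1
    have hGm := (hu.memLp_weakGradient.inner_const (𝕜 := ℝ) e).1
    have hqm := aestronglyMeasurable_diffQuot (t j) e hφm
    have heq : (diffQuot (t j) e u - fun x => inner ℝ (weakGradient u x) e) =
        (diffQuot (t j) e u - diffQuot (t j) e (φ k)) +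
        ((diffQuot (t j) e (φ k) - fun x => fderiv ℝ (φ k) x e) +
        ((fun x => fderiv ℝ (φ k) x e) - fun x => inner ℝ (weakGradient u x) e)) := by abel
    rw [heq]
    refine (eLpNorm_add_le (hum.sub hqm) ((hqm.sub hdm).add (hdm.sub hGm)) (by norm_num)).trans ?_
    refine (add_le_add (h1 k j) ((eLpNorm_add_le (hqm.sub hdm) (hdm.sub hGm) (by norm_num)).trans
      (add_le_add le_rfl (h3 k)))).trans_eq ?_
    ring
  have hηlim : Tendsto (fun k => 2 * (ENNReal.ofReal ‖e‖ * η k)) atTop (𝓝 0) := by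
    have := ENNReal.Tendsto.const_mul (a := 2) (ENNReal.Tendsto.const_mul
      (a := ENNReal.ofReal ‖e‖) hφG (Or.inr ENNReal.ofReal_ne_top)) (Or.inr (by norm_num))
    simpa using this
  rw [ENNReal.tendsto_nhds_zero]
  intro ε hε
  have hε2 : 0 < ε / 2 := ENNReal.half_pos hε.ne'
  obtain ⟨k, hk⟩ := (ENNReal.tendsto_nhds_zero.1 hηlim _ hε2).exists
  filter_upwards [ENNReal.tendsto_nhds_zero.1
    ((hφ k).tendsto_eLpNorm_diffQuot e ht ht1 htl) _ hε2] with j hj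
  exact (htri k j).trans ((add_le_add hk hj).trans_eq (ENNReal.add_halves ε))

theorem MemX.tendsto_integral_diffQuot_mul (hn : 2 < n) (hu : MemX s Ω P₂ u) (hv : MemX s Ω P₂ v)
    (e : 𝔼) {t : ℕ → ℝ} (ht : ∀ j, t j ≠ 0) (ht1 : ∀ j, |t j| ≤ 1) (htl : Tendsto t atTop (𝓝 0)) :
    Tendsto (fun j => ∫ x, diffQuot (t j) e u x * diffQuot (t j) e v x) atTop
      (𝓝 (∫ x, inner ℝ (weakGradient u x) e * inner ℝ (weakGradient v x) e)) :=
  tendsto_integral_mul_of_tendsto_eLpNorm (p := 2) (q := 2)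
    (fun j => hu.memLp_diffQuot hn (ht j) e) (hu.memLp_weakGradient.inner_const e)
    (fun j => hv.memLp_diffQuot hn (ht j) e) (hv.memLp_weakGradient.inner_const e)
    (hu.tendsto_eLpNorm_diffQuot hn e ht ht1 htl) (hv.tendsto_eLpNorm_diffQuot hn e ht ht1 htl)

/-- A pointwise inequality between products of increments integrates to the energy form. -/
theorem energyForm_combination_nonneg (hn : 2 < n) {f₁ h₁ f₂ h₂ : 𝔼 → ℝ} (hf₁ : MemX s Ω P₂ f₁)
    (hh₁ : MemX s Ω P₂ h₁) (hf₂ : MemX s Ω P₂ f₂) (hh₂ : MemX s Ω P₂ h₂) {α β : ℝ} {P : 𝔼 → Prop}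
    (hP : ∀ᵐ x, P x) (hineq : ∀ x y, P x → P y →
      0 ≤ α * ((f₁ x - f₁ y) * (h₁ x - h₁ y)) + β * ((f₂ x - f₂ y) * (h₂ x - h₂ y))) :
    0 ≤ α * energyForm s Ω f₁ h₁ + β * energyForm s Ω f₂ h₂ := by
  have hnonlocal : 0 ≤ α * ∫ p, jump f₁ p * jump h₁ p ∂(jumpMeasure s Ω) +
      β * ∫ p, jump f₂ p * jump h₂ p ∂(jumpMeasure s Ω) := by
    refine integral_mul_combination_nonneg hf₁.memLp_jump hh₁.memLp_jump hf₂.memLp_jump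
      hh₂.memLp_jump ?_
    filter_upwards [ae_jumpMeasure_of_ae s Ω hP] with p hp
    exact hineq p.1 p.2 hp.1 hp.2
  -- The hypothesis at the pair `x + t e`, `x`, multiplied by `t⁻²`, is an inequality between
  -- difference quotients. Integrate it and let `t → 0`; summing over an orthonormal basis then
  -- recovers the inner products of gradients.
  have hlocal : ∀ e : 𝔼,
      0 ≤ α * (∫ x, inner ℝ (weakGradient f₁ x) e * inner ℝ (weakGradient h₁ x) e) +
        β * ∫ x, inner ℝ (weakGradient f₂ x) e * inner ℝ (weakGradient h₂ x) e := by
    intro e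
    set t : ℕ → ℝ := fun j => 1 / ((j : ℝ) + 1) with htdef
    have ht : ∀ j, t j ≠ 0 := fun j => Nat.one_div_pos_of_nat.ne'
    have ht1 : ∀ j, |t j| ≤ 1 := fun j => by
      rw [abs_of_pos Nat.one_div_pos_of_nat, htdef]
      simp only
      rw [div_le_one (by positivity)]
      linarith [Nat.cast_nonneg (α := ℝ) j]
    have htl : Tendsto t atTop (𝓝 0) := tendsto_one_div_add_atTop_nhds_zero_nat
    refine ge_of_tendsto (((hf₁.tendsto_integral_diffQuot_mul hn hh₁ e ht ht1 htl).const_mul α).add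
      ((hf₂.tendsto_integral_diffQuot_mul hn hh₂ e ht ht1 htl).const_mul β))
      (Eventually.of_forall fun j => ?_)
    refine integral_mul_combination_nonneg (hf₁.memLp_diffQuot hn (ht j) e)
      (hh₁.memLp_diffQuot hn (ht j) e) (hf₂.memLp_diffQuot hn (ht j) e)
      (hh₂.memLp_diffQuot hn (ht j) e) ?_
    filter_upwards [hP,
      (measurePreserving_add_right volume (t j • e)).quasiMeasurePreserving.ae hP] with x hx hx'
    have := mul_nonneg (sq_nonneg (t j)⁻¹) (hineq (x + t j • e) x hx' hx)
    simp only [diffQuot]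
    linarith
  rw [energyForm_eq, energyForm_eq,
    integral_inner_eq_sum hf₁.memLp_weakGradient hh₁.memLp_weakGradient,
    integral_inner_eq_sum hf₂.memLp_weakGradient hh₂.memLp_weakGradient]
  have hsum := Finset.sum_nonneg fun i (_ : i ∈ Finset.univ) =>
    hlocal (EuclideanSpace.basisFun (Fin n) ℝ i)
  rw [Finset.sum_add_distrib, ← Finset.mul_sum, ← Finset.mul_sum] at hsum
  linarith

end

/-! ### Nonnegativity of the supersolution on the whole space. -/

theorem lipschitzWith_negPart_snd : LipschitzWith 1 fun z : ℝ × ℝ => max (-z.2) 0 := by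
  refine LipschitzWith.of_dist_le_mul fun z w => ?_
  rw [Real.dist_eq, Prod.dist_eq, Real.dist_eq, Real.dist_eq]
  have h2 := abs_max_sub_max_le_abs (-z.2) (-w.2) 0
  rw [← neg_sub', abs_neg] at h2
  have h5 := le_max_right |z.1 - w.1| |z.2 - w.2|
  simp only [NNReal.coe_one, one_mul]
  linarith

/-- Since `a = a⁺ - a⁻` and `a⁺ a⁻ = 0`, the expression equals `a⁺ b⁻ + b⁺ a⁻`. Integrated, this
gives `ℰ(v, v⁻) ≤ -ℰ(v⁻, v⁻)`. -/
theorem negPart_increment_nonneg (a b : ℝ) :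
    0 ≤ (-1) * ((a - b) * (max (-a) 0 - max (-b) 0)) +
      (-1) * ((max (-a) 0 - max (-b) 0) * (max (-a) 0 - max (-b) 0)) := by
  have h : ∀ c : ℝ, max (-c) 0 * (c + max (-c) 0) = 0 := fun c => by
    rcases le_total c 0 with hc | hc <;> simp [hc]
  have hp := mul_nonneg (le_max_right (-a) 0) (neg_le_iff_add_nonneg'.1 (le_max_left (-b) 0))
  have hq := mul_nonneg (le_max_right (-b) 0) (neg_le_iff_add_nonneg'.1 (le_max_left (-a) 0))
  linarith [h a, h b]

section

variable [NeZero n] {s : ℝ} {Ω P₂ : Set (EuclideanSpace ℝ (Fin n))}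
  {u v : EuclideanSpace ℝ (Fin n) → ℝ}

/-- Sobolev: an element of `𝒳^s(D)` with vanishing gradient vanishes. -/
theorem MemX.ae_eq_zero_of_weakGradient (hn : 2 < n) (hu : MemX s Ω P₂ u)
    (h : weakGradient u =ᵐ[volume] 0) : u =ᵐ[volume] 0 := by
  obtain ⟨φ, hφ, -, hφu, hφG, -⟩ := hu.exists_approx
  have hn' : (2 : ℝ) < n := by exact_mod_cast hn
  set p' : NNReal := Real.toNNReal (2 * (n : ℝ) / ((n : ℝ) - 2)) with hp'
  have hS : sobolevExp n = p' := rfl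
  have hp'r : (p' : ℝ) = 2 * (n : ℝ) / ((n : ℝ) - 2) :=
    Real.coe_toNNReal _ (div_nonneg (by linarith) (by linarith))
  have hsob : ∀ k, eLpNorm (φ k) (sobolevExp n) volume ≤
      SNormLESNormFDerivOfEqConst ℝ (volume : Measure 𝔼) 2 *
        eLpNorm (gradient (φ k)) 2 volume := by
    intro k
    have h1 := eLpNorm_le_eLpNorm_fderiv_of_eq (volume : Measure 𝔼) (F := ℝ) (u := φ k) (p := 2)
      (p' := p') ((hφ k).1.of_le (by simp)) (hφ k).2.1 (by norm_num)
      (by rw [finrank_euclideanSpace_fin]; omega) (by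
        rw [hp'r, finrank_euclideanSpace_fin]
        have h2 : (n : ℝ) - 2 ≠ 0 := by linarith
        have h3 : (n : ℝ) ≠ 0 := by linarith
        push_cast
        field_simp)
    rw [hS]
    refine h1.trans_eq ?_
    congr 1
    exact eLpNorm_congr_norm_ae (Eventually.of_forall fun x => (norm_gradient (φ k) x).symm)
  have h0 : Tendsto (fun k => eLpNorm (gradient (φ k)) 2 volume) atTop (𝓝 0) := by
    refine hφG.congr fun k => eLpNorm_congr_ae ?_
    filter_upwards [h] with x hx
    simp [hx]
  have h1 : Tendsto (fun k => eLpNorm (φ k) (sobolevExp n) volume) atTop (𝓝 0) := by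
    have := ENNReal.Tendsto.const_mul (a := (SNormLESNormFDerivOfEqConst ℝ
      (volume : Measure 𝔼) 2 : ℝ≥0∞)) h0 (Or.inr ENNReal.coe_ne_top)
    rw [mul_zero] at this
    exact tendsto_of_tendsto_of_tendsto_of_le_of_le tendsto_const_nhds this (fun _ => zero_le) hsob
  have h2 : eLpNorm u (sobolevExp n) volume ≤ 0 := by
    have hle : ∀ k, eLpNorm u (sobolevExp n) volume ≤
        eLpNorm (φ k - u) (sobolevExp n) volume + eLpNorm (φ k) (sobolevExp n) volume := by
      intro k
      have hm := (hφ k).1.continuous.aestronglyMeasurable (μ := volume)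
      have := eLpNorm_sub_le hm (hm.sub hu.memLp.1) (one_le_sobolevExp hn)
      rwa [sub_sub_cancel, add_comm] at this
    have := hφu.add h1
    rw [add_zero] at this
    exact ge_of_tendsto' this hle
  exact (eLpNorm_eq_zero_iff hu.memLp.1 (sobolevExp_ne_zero hn)).1 (le_antisymm h2 zero_le)

/-- Both parts of the quadratic form are nonnegative, so the gradient part vanishes and the Sobolev
inequality concludes. -/
theorem MemX.ae_eq_zero_of_energyForm_self_nonpos (hn : 2 < n) (hu : MemX s Ω P₂ u)
    (h : energyForm s Ω u u ≤ 0) : u =ᵐ[volume] 0 := by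
  refine hu.ae_eq_zero_of_weakGradient hn ?_
  rw [energyForm_eq] at h
  have h1 : 0 ≤ ∫ p, jump u p * jump u p ∂(jumpMeasure s Ω) :=
    integral_nonneg fun p => mul_self_nonneg _
  have h2 : 0 ≤ ∫ x, inner ℝ (weakGradient u x) (weakGradient u x) :=
    integral_nonneg fun x => real_inner_self_nonneg
  have h3 : ∫ x, inner ℝ (weakGradient u x) (weakGradient u x) = 0 := by linarith
  have hint : Integrable fun x => inner ℝ (weakGradient u x) (weakGradient u x) := by
    simpa only [real_inner_self_eq_norm_sq] using hu.memLp_weakGradient.norm.integrable_sq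
  filter_upwards [(integral_eq_zero_iff_of_nonneg (fun x => real_inner_self_nonneg) hint).1 h3]
    with x hx
  exact inner_self_eq_zero.1 hx

/-- A supersolution which is positive in `Ω` is nonnegative on the whole space. -/
theorem IsWeakSupersolution.ae_nonneg (hn : 2 < n) {g : 𝔼 → ℝ → ℝ}
    (hv : IsWeakSupersolution s Ω P₂ g v) (hpos : ∀ᵐ x ∂(volume.restrict Ω), 0 < v x) :
    ∀ᵐ x, 0 ≤ v x := by
  have hw : MemX s Ω P₂ fun x => max (-v x) 0 :=
    hv.1.comp_lipschitz hn hv.1 lipschitzWith_negPart_snd (by simp)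
  have h1 := (hv.2 _ hw (Eventually.of_forall fun x => le_max_right _ _)).2
  -- Positivity in `Ω` makes the test function `v⁻` vanish there, so the source term drops out and
  -- `0 ≤ ℰ(v, v⁻) ≤ -ℰ(v⁻, v⁻)`.
  have h2 : ∫ x in Ω, g x (v x) * max (-v x) 0 = 0 := by
    refine integral_eq_zero_of_ae ?_
    filter_upwards [hpos] with x hx
    simp [hx.le]
  have h3 := energyForm_combination_nonneg hn hv.1 hw hw hw (α := -1) (β := -1)
    (P := fun _ => True) (by simp) fun x y _ _ => negPart_increment_nonneg (v x) (v y)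
  have h4 := hw.ae_eq_zero_of_energyForm_self_nonpos hn (by linarith)
  filter_upwards [h4] with x hx
  have := le_max_left (-v x) 0
  rw [Pi.zero_apply] at hx
  linarith

end

end MixedLocalNonlocal

/-! ### The comparison principle. -/

open MixedLocalNonlocal in
theorem lemma3p5 (n : ℕ) [NeZero n] (hn : 2 < n) (s : ℝ) (hs : s ∈ Set.Ioo (0 : ℝ) 1)
    (Ω P₁ P₂ : Set (EuclideanSpace ℝ (Fin n))) (hΩ : IsMixedSetting Ω P₁ P₂)
    (g : EuclideanSpace ℝ (Fin n) → ℝ → ℝ) (hg : IsCaratheodory Ω g)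
    (hdec : ∀ᵐ x ∂(volume.restrict Ω), StrictAntiOn (fun ρ : ℝ => g x ρ / ρ) (Set.Ioi 0))
    (u v : EuclideanSpace ℝ (Fin n) → ℝ)
    (hv : IsWeakSupersolution s Ω P₂ g v) (hv_pos : ∀ᵐ x ∂(volume.restrict Ω), 0 < v x)
    (hu : IsWeakSubsolution s Ω P₂ g u) (hu_pos : ∀ᵐ x ∂(volume.restrict Ω), 0 < u x) :
    ∀ᵐ x ∂(volume.restrict Ω), u x ≤ v x := by
  have hv0 : ∀ᵐ x, 0 ≤ v x := hv.ae_nonneg hn hv_pos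
  have hF₁ : MemX s Ω P₂ fun x => piconeFst (u x, v x) :=
    hu.1.comp_lipschitz hn hv.1 lipschitzWith_piconeFst (by simp [piconeFst, parallelSum])
  have hF₂ : MemX s Ω P₂ fun x => posSub (u x, v x) :=
    hu.1.comp_lipschitz hn hv.1 lipschitzWith_posSub (by simp [posSub])
  obtain ⟨hi₁, he₁⟩ := hu.2 _ hF₁ (Eventually.of_forall fun x => piconeFst_nonneg _)
  obtain ⟨hi₂, he₂⟩ := hv.2 _ hF₂ (Eventually.of_forall fun x => le_max_right _ _)
  have henergy := energyForm_combination_nonneg hn hu.1 hF₁ hv.1 hF₂ (α := 1) (β := -1) hv0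
    fun x y hx hy => by
      have := picone_increment_nonneg (a := u x) (b := u y) hx hy
      linarith
  have hpt : ∀ᵐ x ∂(volume.restrict Ω), 0 ≤ g x (v x) * posSub (u x, v x) -
        g x (u x) * piconeFst (u x, v x) ∧
      (v x < u x → 0 < g x (v x) * posSub (u x, v x) - g x (u x) * piconeFst (u x, v x)) := by
    filter_upwards [hdec, hv_pos, hu_pos] with x hx hvx hux
    rcases lt_or_ge (v x) (u x) with hlt | hle
    · have hpos : 0 < g x (v x) * posSub (u x, v x) - g x (u x) * piconeFst (u x, v x) := by
        have h1 := hx (mem_Ioi.2 hvx) (mem_Ioi.2 hux) hlt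
        simp only at h1
        have h2 : posSub (u x, v x) = u x - v x := max_eq_left (by simpa using hlt.le)
        rw [piconeFst_of_lt hvx.le hlt, h2]
        -- The two test functions have ratio `v / u` where `v < u`, so the source terms combine into
        -- a difference of the quotients `g(x,ρ)/ρ`.
        have h3 : g x (v x) * (u x - v x) - g x (u x) * (v x * (u x - v x) / u x) =
            v x * (u x - v x) * (g x (v x) / v x - g x (u x) / u x) := by
          field_simp
        rw [h3]
        exact mul_pos (mul_pos hvx (sub_pos.2 hlt)) (sub_pos.2 h1)
      exact ⟨hpos.le, fun _ => hpos⟩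
    · have h2 : posSub (u x, v x) = 0 := max_eq_right (by simpa using hle)
      rw [piconeFst_of_le hvx.le hle, h2]
      exact ⟨by simp, fun h => absurd h hle.not_gt⟩
  have hint : Integrable (fun x => g x (v x) * posSub (u x, v x) -
      g x (u x) * piconeFst (u x, v x)) (volume.restrict Ω) := Integrable.sub hi₂ hi₁
  have hzero : ∫ x in Ω, (g x (v x) * posSub (u x, v x) - g x (u x) * piconeFst (u x, v x)) = 0 := by
    refine le_antisymm ?_ (integral_nonneg_of_ae (hpt.mono fun x hx => hx.1))
    -- The upper bound chains the supersolution inequality, Picone and the subsolution inequality: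
    -- `∫ g(x,v) (u - v)⁺ ≤ ℰ(v, (u - v)⁺) ≤ ℰ(u, v (u - v)⁺ / u) ≤ ∫ g(x,u) v (u - v)⁺ / u`.
    rw [integral_sub hi₂ hi₁]
    linarith
  filter_upwards [hpt, (integral_eq_zero_iff_of_nonneg_ae (hpt.mono fun x hx => hx.1) hint).1 hzero]
    with x hx hx0
  by_contra hlt
  exact (hx.2 (not_le.1 hlt)).ne' hx0
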